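/- Let $k$ be an algebraically closed field with $\operatorname{char} k\neq 2$, and let $D(\Lambda_2)$ (the Drinfel'd double of the Taft algebra for $n=2$) be the $k$-algebra generated by $x,X,g,G$ subject to $$x^2=X^2=0,\quad g^2=G^2=1,\quad gG=Gg,\quad gx=-xg,\quad gX=-Xg,\quad Gx=-xG,\quad GX=-XG,\quad xX+Xx=1-gG .$$ For $\alpha,\beta\in k$ let $H_{\alpha\beta}$ be the subalgebra generated by $g$, $G$ and $\alpha x+\beta X$. All modules are finite-dimensional left modules. For a $D(\Lambda_2)$-module $M$ define its rank variety by $$V^r(M)=\{0\}\cup\{(\alpha,\beta)\in k^2 : M|_{H_{\alpha\beta}}\text{ is not projective}\}\subseteq k^2 .$$ Let $\Omega(M)$ denote the kernel of a projective cover of $M$, let $\Omega^{-1}(M)$ denote the cokernel of an injective hull of $M$, and let $\Omega^{n}(M)$, $n\in\mathbb Z$, denote their iterates, with $\Omega^0(M)=M$ (these modules exist, and are determined up to isomorphism). Then the family $\{H_{\alpha\beta} : (\alpha,\beta)\neq(0,0)\}$ detects projectivity: a $D(\Lambda_2)$-module $M$ is projective if and only if $M|_{H_{\alpha\beta}}$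 is projective for all $(\alpha,\beta)\neq(0,0)$. Moreover, $V^r$ satisfies the following conditions. (C1) $V^r(M\oplus N)=V^r(M)\cup V^r(N)$ for all $D(\Lambda_2)$-modules $M,N$. (C2) If $0\to M_1\to M_2\to M_3\to 0$ is an exact sequence of $D(\Lambda_2)$-modules, then $V^r(M_i)\subseteq V^r(M_j)\cup V^r(M_s)$ whenever $\{i,j,s\}=\{1,2,3\}$. (C3) $V^r(\Omega^n(M))=V^r(M)$ for all $n\in\mathbb Z$ and all $D(\Lambda_2)$-modules $M$. (C4) (Dade's Lemma) $V^r(M)=\{0\}$ if and only if $M$ is projective. -/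

import Mathlib

universe u

/-! ### Finite-dimensional modules over a `k`-algebra -/

/-- A finite-dimensional left module over the `k`-algebra `A`: an object of `A`-mod. -/
structure FDMod (k A : Type u) [Field k] [Ring A] [Algebra k A] : Type (u + 1) where
  carrier : Type u
  [addCommGroup : AddCommGroup carrier]
  [moduleBase : Module k carrier]
  [module : Module A carrier]
  [isScalarTower : IsScalarTower k A carrier]
  [finiteDimensional : FiniteDimensional k carrier]

namespace FDMod

variable {k A : Type u} [Field k] [Ring A] [Algebra k A]

instance : CoeSort (FDMod k A) (Type u) := ⟨FDMod.carrier⟩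

attribute [instance] FDMod.addCommGroup FDMod.moduleBase FDMod.module
  FDMod.isScalarTower FDMod.finiteDimensional

/-- The direct sum `M ⊕ N`. -/
def directSum (M N : FDMod k A) : FDMod k A where
  carrier := M × N

/-- `π : P → M` is a projective cover: `P` is projective, `π` is surjective and its kernel is a
superfluous submodule of `P`. -/
def IsProjectiveCover {P M : FDMod k A} (π : P →ₗ[A] M) : Prop :=
  Module.Projective A P ∧ Function.Surjective π ∧
    ∀ U : Submodule A P, U ⊔ LinearMap.ker π = ⊤ → U = ⊤

/-- `ι : M → I` is an injective hull: `I` is injective, `ι` is injective and its image is an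
essential submodule of `I`. -/
def IsInjectiveHull {M I : FDMod k A} (ι : M →ₗ[A] I) : Prop :=
  Module.Injective A I ∧ Function.Injective ι ∧
    ∀ U : Submodule A I, U ⊓ LinearMap.range ι = ⊥ → U = ⊥

/-- `N ≅ Ω(M)`: `N` is isomorphic to the kernel of a projective cover of `M`, that is, there is an
exact sequence `0 → N → P → M → 0` in which `P → M` is a projective cover. -/
def IsOmega (M N : FDMod k A) : Prop :=
  ∃ (P : FDMod k A) (i : N →ₗ[A] P) (π : P →ₗ[A] M),
    IsProjectiveCover π ∧ Function.Injective i ∧ Function.Exact i π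

/-- `N ≅ Ω⁻¹(M)`: `N` is isomorphic to the cokernel of an injective hull of `M`, that is, there is
an exact sequence `0 → M → I → N → 0` in which `M → I` is an injective hull. -/
def IsOmegaInv (M N : FDMod k A) : Prop :=
  ∃ (I : FDMod k A) (ι : M →ₗ[A] I) (p : I →ₗ[A] N),
    IsInjectiveHull ι ∧ Function.Surjective p ∧ Function.Exact ι p

/-- The `n`-fold iterate of a binary relation `R` on modules, starting from isomorphism. -/
def IterateRel (R : FDMod k A → FDMod k A → Prop) : ℕ → FDMod k A → FDMod k A → Prop
  | 0, M, N => Nonempty (M ≃ₗ[A] N)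
  | n + 1, M, N => ∃ L : FDMod k A, IterateRel R n M L ∧ R L N

/-- `N ≅ Ωⁿ(M)`, for an integer `n`. -/
def IsOmegaPow : ℤ → FDMod k A → FDMod k A → Prop
  | Int.ofNat n => IterateRel IsOmega n
  | Int.negSucc n => IterateRel IsOmegaInv (n + 1)

end FDMod

/-! ### Detecting projectivity, and the conditions (C1)-(C4) -/

section Conditions

variable {k A : Type u} [Field k] [Ring A] [Algebra k A]

/-- A collection of subalgebras of `A` detects projectivity if a (finite-dimensional) `A`-module is
projective if and only if its restriction to every member of the collection is projective. -/
def DetectsProjectivity (𝒜 : Set (Subalgebra k A)) : Prop :=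
  ∀ M : FDMod k A, Module.Projective A M ↔ ∀ B ∈ 𝒜, Module.Projective B M

variable {S : Type u}

/-- (C1): `V(M ⊕ N) = V(M) ∪ V(N)`. -/
def CondC1 (V : FDMod k A → Set S) : Prop :=
  ∀ M N : FDMod k A, V (M.directSum N) = V M ∪ V N

/-- (C2): for every short exact sequence `0 → M₁ → M₂ → M₃ → 0`, each `V(Mᵢ)` is contained in the
union of the other two. -/
def CondC2 (V : FDMod k A → Set S) : Prop :=
  ∀ (M₁ M₂ M₃ : FDMod k A) (f : M₁ →ₗ[A] M₂) (h : M₂ →ₗ[A] M₃),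
    Function.Injective f → Function.Exact f h → Function.Surjective h →
      V M₁ ⊆ V M₂ ∪ V M₃ ∧ V M₂ ⊆ V M₁ ∪ V M₃ ∧ V M₃ ⊆ V M₁ ∪ V M₂

/-- (C3): for every integer `n` and every `M`, the module `Ωⁿ(M)` exists and
`V(Ωⁿ(M)) = V(M)`. -/
def CondC3 (V : FDMod k A → Set S) : Prop :=
  ∀ (n : ℤ) (M : FDMod k A),
    (∃ N : FDMod k A, FDMod.IsOmegaPow n M N) ∧
      ∀ N : FDMod k A, FDMod.IsOmegaPow n M N → V N = V M

/-- (C4), Dade's Lemma: `V(M) = {0}` if and only if `M` is projective. -/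
def CondC4 [Zero S] (V : FDMod k A → Set S) : Prop :=
  ∀ M : FDMod k A, V M = {0} ↔ Module.Projective A M

end Conditions

/-! ### The Drinfel'd double of the Taft algebra for `n = 2` -/

namespace DTaft

/-- The four generators. -/
inductive Gen : Type
  | x | X | g | G

/-- A generator as an element of the free algebra. -/
abbrev fr (k : Type u) [Field k] (a : Gen) : FreeAlgebra k Gen := FreeAlgebra.ι k a

/-- The defining relations of `D(Λ₂)`. -/
inductive Rel (k : Type u) [Field k] : FreeAlgebra k Gen → FreeAlgebra k Gen → Prop
  | x_sq : Rel k (fr k .x ^ 2) 0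
  | X_sq : Rel k (fr k .X ^ 2) 0
  | g_sq : Rel k (fr k .g ^ 2) 1
  | G_sq : Rel k (fr k .G ^ 2) 1
  | g_G : Rel k (fr k .g * fr k .G) (fr k .G * fr k .g)
  | g_x : Rel k (fr k .g * fr k .x) (-(fr k .x * fr k .g))
  | g_X : Rel k (fr k .g * fr k .X) (-(fr k .X * fr k .g))
  | G_x : Rel k (fr k .G * fr k .x) (-(fr k .x * fr k .G))
  | G_X : Rel k (fr k .G * fr k .X) (-(fr k .X * fr k .G))
  | x_X : Rel k (fr k .x * fr k .X + fr k .X * fr k .x) (1 - fr k .g * fr k .G)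

/-- The algebra `D(Λ₂)` over `k`, by generators and relations. -/
abbrev D (k : Type u) [Field k] : Type u := RingQuot (Rel k)

/-- A generator as an element of `D(Λ₂)`. -/
noncomputable def gen (k : Type u) [Field k] (a : Gen) : D k :=
  RingQuot.mkAlgHom k (Rel k) (FreeAlgebra.ι k a)

/-- The subalgebra `H_{αβ}` of `D(Λ₂)` generated by `g`, `G` and `αx + βX`. -/
noncomputable def H (k : Type u) [Field k] (α β : k) : Subalgebra k (D k) :=
  Algebra.adjoin k {gen k .g, gen k .G, α • gen k .x + β • gen k .X}

/-- The rank variety `Vʳ(M) = {0} ∪ {(α, β) ∈ k² : M restricted to H_{αβ} is not projective}`. -/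
def rankVariety (k : Type u) [Field k] (M : FDMod k (D k)) : Set (k × k) :=
  {0} ∪ {p : k × k | ¬ Module.Projective (H k p.1 p.2) M}

end DTaft

/-!
An element `T` of `A ⊗ A` with `(a ⊗ 1) T = T (1 ⊗ a)` turns `k`-linear maps between `A`-modules
into `A`-linear ones, so a module whose identity arises in this way is projective and injective.
With two commuting involutions `g`, `G` and odd elements available, such Casimir elements are signed
commutators of an average over the group generated by `g` and `G`. One signed commutator serves for
`H_{αβ}`: `M` is projective over it iff `αx + βX` has a contracting homotopy on `M`. An iterated one
serves for `D(Λ₂)`; being alternating in the odd elements, it is up to a scalar independent of the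
basis chosen for the span of `x` and `X`, whence projectivity restricts to every `H_{αβ}`.

Conversely, suppose that every `αx + βX` with `(α, β) ≠ (0, 0)` has a contracting homotopy, and
split `M` by the central involution `gG`. On the part with `gG = -1` we have `xX + Xx = 2`, and
`X / 2`, `x / 2` yield the identity as a trace outright. On the part with `gG = 1` the elements `x`
and `X` generate an action of an exterior algebra, and it suffices that `ker (xX) = xM + XM`: some
trace then agrees with the identity up to a nilpotent endomorphism. On `ker (xX)` the relation
`x (T v) = X v` defines an endomorphism `T` preserving `xM + XM`; if `ker (xX)` were larger, an
eigenvector of `T` on the quotient with eigenvalue `c` would give a cycle of `X - c x` which is not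
a boundary.
-/

open TensorProduct

section Casimir

variable {k A : Type*} [CommRing k] [Ring A] [Algebra k A]
variable {M N P : Type*}
  [AddCommGroup M] [Module k M] [Module A M] [IsScalarTower k A M]
  [AddCommGroup N] [Module k N] [Module A N] [IsScalarTower k A N]
  [AddCommGroup P] [Module k P] [Module A P] [IsScalarTower k A P]

/-- The action of `A ⊗ A` on `k`-linear maps between `A`-modules: `a ⊗ b` sends `u` to
`m ↦ a • u (b • m)`. -/
noncomputable def sandwich : A ⊗[k] A →ₗ[k] (M →ₗ[k] N) →ₗ[k] (M →ₗ[k] N) :=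
  TensorProduct.lift <| LinearMap.mk₂ k
    (fun a b => LinearMap.compRight k (Algebra.lsmul k k N a) ∘ₗ
      LinearMap.lcomp k N (Algebra.lsmul k k M b))
    (fun a a' b => by ext; simp)
    (fun c a b => by ext; simp)
    (fun a b b' => by ext; simp)
    (fun c a b => by ext; simp [smul_comm a c])

@[simp]
theorem sandwich_tmul_apply (a b : A) (u : M →ₗ[k] N) (m : M) :
    sandwich (a ⊗ₜ[k] b) u m = a • u (b • m) :=
  rfl

theorem sandwich_tmul_one_mul (a : A) (T : A ⊗[k] A) (u : M →ₗ[k] N) (m : M) :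
    sandwich ((a ⊗ₜ 1) * T) u m = a • sandwich T u m := by
  induction T with
  | zero => simp
  | tmul b c => simp [mul_smul]
  | add S T hS hT => simp [mul_add, hS, hT]

theorem sandwich_mul_one_tmul (a : A) (T : A ⊗[k] A) (u : M →ₗ[k] N) (m : M) :
    sandwich (T * (1 ⊗ₜ a)) u m = sandwich T u (a • m) := by
  induction T with
  | zero => simp
  | tmul b c => simp [mul_smul]
  | add S T hS hT => simp [add_mul, hS, hT]

theorem sandwich_mul_tmul_one (a : A) (T : A ⊗[k] A) (u : M →ₗ[k] N) :
    sandwich (T * (a ⊗ₜ 1)) u = sandwich T (Algebra.lsmul k k N a ∘ₗ u) := by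
  induction T with
  | zero => simp
  | tmul b c => ext; simp [mul_smul]
  | add S T hS hT => simp [add_mul, hS, hT]

theorem sandwich_one_tmul_mul (a : A) (T : A ⊗[k] A) (u : M →ₗ[k] N) :
    sandwich ((1 ⊗ₜ a) * T) u = sandwich T (u ∘ₗ Algebra.lsmul k k M a) := by
  induction T with
  | zero => simp
  | tmul b c => ext; simp [mul_smul]
  | add S T hS hT => simp [mul_add, hS, hT]

theorem sandwich_restrictScalars_comp (T : A ⊗[k] A) (f : N →ₗ[A] P) (u : M →ₗ[k] N) :
    sandwich T (f.restrictScalars k ∘ₗ u) = f.restrictScalars k ∘ₗ sandwich T u := by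
  induction T with
  | zero => simp
  | tmul b c => ext; simp
  | add S T hS hT => simp [hS, hT, LinearMap.comp_add]

theorem sandwich_comp_restrictScalars (T : A ⊗[k] A) (f : M →ₗ[A] N) (u : N →ₗ[k] P) :
    sandwich T (u ∘ₗ f.restrictScalars k) = sandwich T u ∘ₗ f.restrictScalars k := by
  induction T with
  | zero => simp
  | tmul b c => ext; simp
  | add S T hS hT => simp [hS, hT, LinearMap.add_comp]

/-- The subalgebra of those `a` on which the left action on the first factor of `T` agrees with the
right action on the second factor, so that the sandwich action of `T` yields maps commuting with
`a`. -/
def tensorCentralizer (T : A ⊗[k] A) : Subalgebra k A where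
  carrier := {a | (a ⊗ₜ 1) * T = T * (1 ⊗ₜ a)}
  mul_mem' {a b} ha hb := by
    calc ((a * b) ⊗ₜ[k] 1) * T = (a ⊗ₜ 1) * ((b ⊗ₜ 1) * T) := by simp [← mul_assoc]
      _ = ((a ⊗ₜ 1) * T) * (1 ⊗ₜ b) := by rw [Set.mem_ofPred.mp hb, mul_assoc]
      _ = T * (1 ⊗ₜ (a * b)) := by simp [Set.mem_ofPred.mp ha, mul_assoc]
  add_mem' {a b} ha hb := by
    rw [Set.mem_ofPred, TensorProduct.add_tmul, TensorProduct.tmul_add, add_mul, mul_add,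
      Set.mem_ofPred.mp ha, Set.mem_ofPred.mp hb]
  algebraMap_mem' c := by
    simp only [Set.mem_ofPred, Algebra.algebraMap_eq_smul_one, ← TensorProduct.smul_tmul',
      TensorProduct.tmul_smul, smul_mul_assoc, mul_smul_comm, ← Algebra.TensorProduct.one_def,
      one_mul, mul_one]

theorem mem_tensorCentralizer {a : A} {T : A ⊗[k] A} :
    a ∈ tensorCentralizer T ↔ (a ⊗ₜ 1) * T = T * (1 ⊗ₜ a) :=
  Iff.rfl

/-- A Casimir element of `A ⊗ A`, that is, an `A`-central element of this bimodule. The sandwich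
action of a Casimir element turns `k`-linear maps into `A`-linear ones. -/
def IsCasimir (T : A ⊗[k] A) : Prop :=
  tensorCentralizer T = ⊤

theorem IsCasimir.of_adjoin_eq_top {T : A ⊗[k] A} {s : Set A} (hs : Algebra.adjoin k s = ⊤)
    (h : s ⊆ tensorCentralizer T) : IsCasimir T :=
  top_le_iff.mp (hs ▸ Algebra.adjoin_le h)

namespace IsCasimir

variable {T : A ⊗[k] A} (hT : IsCasimir T)

/-- The `A`-linear map obtained from a `k`-linear one by the action of a Casimir element. -/
noncomputable def trace (u : M →ₗ[k] N) : M →ₗ[A] N where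
  __ := sandwich T u
  map_smul' a m := by
    have ha : a ∈ tensorCentralizer T := hT ▸ Algebra.mem_top
    simp [← sandwich_mul_one_tmul, ← mem_tensorCentralizer.mp ha, sandwich_tmul_one_mul]

theorem trace_apply (u : M →ₗ[k] N) (m : M) : hT.trace u m = sandwich T u m :=
  rfl

end IsCasimir

/-- Some `k`-linear endomorphism of `M` has the identity as its image under `T`. For a Casimir
element `T` this is Higman's criterion for relative projectivity over `k`. -/
def HasUnitTrace (T : A ⊗[k] A) (M : Type*) [AddCommGroup M] [Module k M] [Module A M]
    [IsScalarTower k A M] : Prop :=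
  ∃ t : M →ₗ[k] M, sandwich T t = LinearMap.id

namespace HasUnitTrace

variable {T : A ⊗[k] A}

theorem of_retract (hM : HasUnitTrace T M) (i : N →ₗ[A] M) (r : M →ₗ[A] N)
    (hri : r ∘ₗ i = LinearMap.id) : HasUnitTrace T N := by
  obtain ⟨t, ht⟩ := hM
  refine ⟨r.restrictScalars k ∘ₗ t ∘ₗ i.restrictScalars k, ?_⟩
  rw [sandwich_restrictScalars_comp, sandwich_comp_restrictScalars, ht]
  exact LinearMap.ext fun m => LinearMap.congr_fun hri m

theorem of_add_eq_id (hM : HasUnitTrace T M) (hN : HasUnitTrace T N)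
    (i : M →ₗ[A] P) (r : P →ₗ[A] M) (j : N →ₗ[A] P) (s : P →ₗ[A] N)
    (h : i ∘ₗ r + j ∘ₗ s = LinearMap.id) : HasUnitTrace T P := by
  obtain ⟨t, ht⟩ := hM
  obtain ⟨t', ht'⟩ := hN
  refine ⟨i.restrictScalars k ∘ₗ t ∘ₗ r.restrictScalars k +
    j.restrictScalars k ∘ₗ t' ∘ₗ s.restrictScalars k, ?_⟩
  rw [map_add, sandwich_restrictScalars_comp, sandwich_restrictScalars_comp,
    sandwich_comp_restrictScalars, sandwich_comp_restrictScalars, ht, ht']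
  exact LinearMap.ext fun m => LinearMap.congr_fun h m

theorem of_isUnit (hT : IsCasimir T) (t : M →ₗ[k] M) (ht : IsUnit (hT.trace t : Module.End A M)) :
    HasUnitTrace T M := by
  obtain ⟨e, he⟩ := ht
  refine ⟨(e⁻¹).val.restrictScalars k ∘ₗ t, ?_⟩
  rw [sandwich_restrictScalars_comp]
  refine LinearMap.ext fun m => ?_
  change (e⁻¹).val (hT.trace t m) = m
  rw [← he, ← Module.End.mul_apply, Units.inv_mul, Module.End.one_apply]

end HasUnitTrace

end Casimir

section Higman

namespace HasUnitTrace

variable {k A : Type*} [Field k] [Ring A] [Algebra k A] {T : A ⊗[k] A}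
variable {M N P : Type*}
  [AddCommGroup M] [Module k M] [Module A M] [IsScalarTower k A M]
  [AddCommGroup N] [Module k N] [Module A N] [IsScalarTower k A N]
  [AddCommGroup P] [Module k P] [Module A P] [IsScalarTower k A P]

theorem exists_section (hM : HasUnitTrace T M) (hT : IsCasimir T) (q : N →ₗ[A] M)
    (hq : Function.Surjective q) : ∃ s : M →ₗ[A] N, q ∘ₗ s = LinearMap.id := by
  obtain ⟨t, ht⟩ := hM
  obtain ⟨s, hs⟩ := (q.restrictScalars k).exists_rightInverse_of_surjective
    (LinearMap.range_eq_top.mpr hq)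
  refine ⟨hT.trace (s ∘ₗ t), LinearMap.ext fun m => ?_⟩
  have key : q.restrictScalars k ∘ₗ sandwich T (s ∘ₗ t) = LinearMap.id := by
    rw [← sandwich_restrictScalars_comp, ← LinearMap.comp_assoc, hs, LinearMap.id_comp, ht]
  exact LinearMap.congr_fun key m

theorem exists_extension (hM : HasUnitTrace T M) (hT : IsCasimir T) (f : N →ₗ[A] P)
    (hf : Function.Injective f) (w : N →ₗ[A] M) : ∃ v : P →ₗ[A] M, v ∘ₗ f = w := by
  obtain ⟨t, ht⟩ := hM
  obtain ⟨r, hr⟩ := (f.restrictScalars k).exists_leftInverse_of_injective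
    (LinearMap.ker_eq_bot.mpr hf)
  refine ⟨hT.trace (t ∘ₗ w.restrictScalars k ∘ₗ r), LinearMap.ext fun m => ?_⟩
  have key : sandwich T (t ∘ₗ w.restrictScalars k ∘ₗ r) ∘ₗ f.restrictScalars k =
      w.restrictScalars k := by
    rw [← sandwich_comp_restrictScalars, LinearMap.comp_assoc, LinearMap.comp_assoc, hr,
      LinearMap.comp_id, sandwich_comp_restrictScalars, ht, LinearMap.id_comp]
  exact LinearMap.congr_fun key m

theorem projective (hM : HasUnitTrace T M) (hT : IsCasimir T) : Module.Projective A M := by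
  obtain ⟨s, hs⟩ := hM.exists_section hT (Finsupp.linearCombination A id)
    (Finsupp.linearCombination_id_surjective A M)
  exact .of_split s _ hs

theorem injective {k : Type*} {A M : Type u} [Field k] [Ring A] [Algebra k A]
    [AddCommGroup M] [Module k M] [Module A M] [IsScalarTower k A M] {T : A ⊗[k] A}
    (hM : HasUnitTrace T M) (hT : IsCasimir T) : Module.Injective A M where
  out P Q _ _ _ _ f hf w := by
    let _ : Module k P := Module.compHom P (algebraMap k A)
    let _ : Module k Q := Module.compHom Q (algebraMap k A)
    have _ : IsScalarTower k A P := .of_algebraMap_smul fun _ _ => rfl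
    have _ : IsScalarTower k A Q := .of_algebraMap_smul fun _ _ => rfl
    obtain ⟨v, hv⟩ := hM.exists_extension hT f hf w
    exact ⟨v, LinearMap.congr_fun hv⟩

end HasUnitTrace

end Higman

section SignedCommutator

variable {k A : Type*} [CommRing k] [Ring A] [Algebra k A]

/-- The signed commutator `(a ⊗ 1) * T - ε • T * (1 ⊗ a)` of an element of `A` with an element of
the bimodule `A ⊗ A`. -/
noncomputable def signedCommutator (ε : k) : A →ₗ[k] A ⊗[k] A →ₗ[k] A ⊗[k] A :=
  LinearMap.mul k (A ⊗[k] A) ∘ₗ Algebra.TensorProduct.includeLeft.toLinearMap -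
    ε • (LinearMap.mul k (A ⊗[k] A)).flip ∘ₗ Algebra.TensorProduct.includeRight.toLinearMap

theorem signedCommutator_apply (ε : k) (a : A) (T : A ⊗[k] A) :
    signedCommutator ε a T = (a ⊗ₜ 1) * T - ε • (T * (1 ⊗ₜ a)) :=
  rfl

theorem signedCommutator_eq_zero_iff {ε : k} {a : A} {T : A ⊗[k] A} :
    signedCommutator ε a T = 0 ↔ (a ⊗ₜ 1) * T = ε • (T * (1 ⊗ₜ a)) :=
  sub_eq_zero

theorem mem_tensorCentralizer_iff_signedCommutator {a : A} {T : A ⊗[k] A} :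
    a ∈ tensorCentralizer T ↔ signedCommutator (1 : k) a T = 0 := by
  rw [signedCommutator_eq_zero_iff, one_smul, mem_tensorCentralizer]

theorem signedCommutator_of_anticomm {ε : k} {a b : A} {T : A ⊗[k] A} (hab : a * b = -(b * a))
    (ha : signedCommutator ε a T = 0) (η : k) :
    signedCommutator (-ε) a (signedCommutator η b T) = 0 := by
  rw [signedCommutator_eq_zero_iff] at ha ⊢
  have hab₁ : (a ⊗ₜ[k] (1 : A)) * (b ⊗ₜ 1) = -((b ⊗ₜ 1) * (a ⊗ₜ 1)) := by
    simp [hab, TensorProduct.neg_tmul]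
  have hab₂ : ((1 : A) ⊗ₜ[k] a) * (1 ⊗ₜ b) = -((1 ⊗ₜ b) * (1 ⊗ₜ a)) := by
    simp [hab, TensorProduct.tmul_neg]
  calc (a ⊗ₜ[k] 1) * signedCommutator η b T
      = (a ⊗ₜ 1) * (b ⊗ₜ 1) * T - η • ((a ⊗ₜ 1) * T * (1 ⊗ₜ b)) := by
        rw [signedCommutator_apply, mul_sub, mul_smul_comm, mul_assoc, mul_assoc]
    _ = -ε • (signedCommutator η b T * (1 ⊗ₜ a)) := by
        rw [hab₁, neg_mul, mul_assoc, ha, smul_mul_assoc, mul_assoc T, hab₂,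
          signedCommutator_apply, sub_mul, smul_mul_assoc, mul_smul_comm, mul_neg,
          ← mul_assoc, ← mul_assoc]
        module

theorem signedCommutator_signedCommutator_neg {ε : k} (hε : ε * ε = 1) (a : A) (T : A ⊗[k] A) :
    signedCommutator ε a (signedCommutator (-ε) a T) = signedCommutator (1 : k) (a * a) T := by
  have h₁ : ((a * a) ⊗ₜ[k] (1 : A)) = (a ⊗ₜ 1) * (a ⊗ₜ 1) := by simp
  have h₂ : ((1 : A) ⊗ₜ[k] (a * a)) = (1 ⊗ₜ a) * (1 ⊗ₜ a) := by simp
  simp only [signedCommutator_apply, h₁, h₂, mul_sub, sub_mul, mul_smul_comm, smul_mul_assoc,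
    smul_sub, smul_smul, mul_neg, hε, mul_assoc]
  module

theorem mul_mem_tensorCentralizer {ε : k} (hε : ε * ε = 1) {a b : A} {T : A ⊗[k] A}
    (ha : signedCommutator ε a T = 0) (hb : signedCommutator ε b T = 0) :
    a * b ∈ tensorCentralizer T := by
  rw [signedCommutator_eq_zero_iff] at ha hb
  calc ((a * b) ⊗ₜ[k] 1) * T = (a ⊗ₜ 1) * ((b ⊗ₜ 1) * T) := by simp [← mul_assoc]
    _ = (ε * ε) • (T * ((1 ⊗ₜ a) * (1 ⊗ₜ b))) := by
      rw [hb, mul_smul_comm, ← mul_assoc, ha, smul_mul_assoc, smul_smul, mul_assoc]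
    _ = T * (1 ⊗ₜ (a * b)) := by simp [hε]

theorem sandwich_signedCommutator {M N : Type*}
    [AddCommGroup M] [Module k M] [Module A M] [IsScalarTower k A M]
    [AddCommGroup N] [Module k N] [Module A N] [IsScalarTower k A N]
    (ε : k) (a : A) (T : A ⊗[k] A) (u : M →ₗ[k] N) (m : M) :
    sandwich (signedCommutator ε a T) u m = a • sandwich T u m - ε • sandwich T u (a • m) := by
  rw [signedCommutator_apply, map_sub, map_smul, LinearMap.sub_apply, LinearMap.sub_apply,
    LinearMap.smul_apply, LinearMap.smul_apply, sandwich_tmul_one_mul, sandwich_mul_one_tmul]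

end SignedCommutator

section KleinPair

/-- Two commuting involutions. -/
structure IsKleinPair {A : Type*} [Ring A] (g G : A) : Prop where
  sq_left : g * g = 1
  sq_right : G * G = 1
  comm : g * G = G * g

/-- The element `y` anticommutes with `g` and with `G`. -/
structure IsOdd {A : Type*} [Ring A] (g G y : A) : Prop where
  left : g * y = -(y * g)
  right : G * y = -(y * G)

variable {k A : Type*} [CommRing k] [Ring A] [Algebra k A]

/-- The sum of `χ a • a ⊗ a⁻¹` over the group generated by `g` and `G`, for the character `χ` with
value `ε` at `g` and at `G`: up to the factor `4`, its sandwich action for `ε = 1` (for `ε = -1`) is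
the projection of the `k`-linear maps onto those which commute (anticommute) with `g` and `G`. -/
noncomputable def kleinAverage (g G : A) (ε : k) : A ⊗[k] A :=
  1 + ε • g ⊗ₜ g + ε • G ⊗ₜ G + (g * G) ⊗ₜ (g * G)

namespace IsKleinPair

variable {g G : A} (hgG : IsKleinPair g G)
include hgG

theorem symm : IsKleinPair G g :=
  ⟨hgG.sq_right, hgG.sq_left, hgG.comm.symm⟩

theorem kleinAverage_swap (ε : k) : kleinAverage G g ε = kleinAverage g G ε := by
  rw [kleinAverage, kleinAverage, hgG.comm, add_right_comm 1]

theorem signedCommutator_left_kleinAverage {ε : k} (hε : ε * ε = 1) :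
    signedCommutator ε g (kleinAverage g G ε) = 0 := by
  have h₁ : g * (g * G) = G := by rw [← mul_assoc, hgG.sq_left, one_mul]
  have h₂ : g * G * g = G := by rw [hgG.comm, mul_assoc, hgG.sq_left, mul_one]
  simp only [signedCommutator_eq_zero_iff, kleinAverage, mul_add, add_mul, mul_one, one_mul,
    mul_smul_comm, smul_mul_assoc, Algebra.TensorProduct.tmul_mul_tmul, smul_add, smul_smul, hε,
    one_smul, hgG.sq_left, h₁, h₂, ← hgG.comm]
  abel

theorem signedCommutator_right_kleinAverage {ε : k} (hε : ε * ε = 1) :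
    signedCommutator ε G (kleinAverage g G ε) = 0 := by
  rw [← hgG.kleinAverage_swap, hgG.symm.signedCommutator_left_kleinAverage hε]

theorem sandwich_kleinAverage {M N : Type*}
    [AddCommGroup M] [Module k M] [Module A M] [IsScalarTower k A M]
    [AddCommGroup N] [Module k N] [Module A N] [IsScalarTower k A N]
    {u : M →ₗ[k] N} (hg : ∀ m, u (g • m) = g • u m) (hG : ∀ m, u (G • m) = G • u m) :
    sandwich (kleinAverage g G (1 : k)) u = (4 : k) • u := by
  ext m
  have h₁ : g • g • u m = u m := by rw [smul_smul, hgG.sq_left, one_smul]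
  have h₂ : G • G • u m = u m := by rw [smul_smul, hgG.sq_right, one_smul]
  have h₃ : G • g • G • u m = g • u m := by rw [smul_smul, ← hgG.comm, mul_smul, h₂]
  simp only [kleinAverage, Algebra.TensorProduct.one_def, one_smul, map_add, LinearMap.add_apply,
    sandwich_tmul_apply, mul_smul, hg, hG, h₁, h₂, h₃, LinearMap.smul_apply]
  module

end IsKleinPair

namespace IsOdd

variable {g G x y : A}

theorem left_smul (hy : IsOdd g G y) {M : Type*} [AddCommGroup M] [Module A M] (m : M) :
    g • y • m = -(y • g • m) := by
  rw [smul_smul, hy.left, neg_smul, mul_smul]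

theorem right_smul (hy : IsOdd g G y) {M : Type*} [AddCommGroup M] [Module A M] (m : M) :
    G • y • m = -(y • G • m) := by
  rw [smul_smul, hy.right, neg_smul, mul_smul]

theorem commute (hy : IsOdd g G y) : Commute (g * G) y := by
  rw [commute_iff_eq, mul_assoc, hy.right, mul_neg, ← mul_assoc, hy.left, neg_mul, neg_neg,
    mul_assoc]

theorem linear_combination (hx : IsOdd g G x) (hy : IsOdd g G y) (α β : k) :
    IsOdd g G (α • x + β • y) where
  left := by simp [mul_add, add_mul, hx.left, hy.left, add_comm]
  right := by simp [mul_add, add_mul, hx.right, hy.right, add_comm]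

theorem tmul_one_mul_kleinAverage (hy : IsOdd g G y) (ε : k) :
    (y ⊗ₜ 1) * kleinAverage g G (-ε) = kleinAverage g G ε * (y ⊗ₜ 1) := by
  simp only [kleinAverage, mul_add, add_mul, mul_one, one_mul, mul_smul_comm, smul_mul_assoc,
    Algebra.TensorProduct.tmul_mul_tmul, hy.left, hy.right, hy.commute.eq,
    TensorProduct.neg_tmul, mul_neg, smul_neg, neg_smul]

theorem one_tmul_mul_kleinAverage (hy : IsOdd g G y) (ε : k) :
    kleinAverage g G (-ε) * (1 ⊗ₜ y) = (1 ⊗ₜ y) * kleinAverage g G ε := by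
  simp only [kleinAverage, mul_add, add_mul, mul_one, one_mul, mul_smul_comm, smul_mul_assoc,
    Algebra.TensorProduct.tmul_mul_tmul, hy.left, hy.right, hy.commute.eq,
    TensorProduct.tmul_neg, neg_mul, smul_neg, neg_smul, neg_neg]

end IsOdd

end KleinPair

section OddCasimir

variable {k A : Type*} [CommRing k] [Ring A] [Algebra k A] {g G : A}

/-- The Casimir element of an algebra generated by a Klein pair `g`, `G` and an odd element `y`
whose square is a multiple of `1 - g * G`. -/
noncomputable def oddCasimir (k : Type*) {A : Type*} [CommRing k] [Ring A] [Algebra k A]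
    (g G y : A) : A ⊗[k] A :=
  signedCommutator (-1 : k) y (kleinAverage g G (-1))

/-- The iterated signed commutator of two elements with the Klein average. On a span of odd elements
whose squares are combinations of `1` and `gG` it is an alternating bilinear form. -/
noncomputable def oddBracket (k : Type*) {A : Type*} [CommRing k] [Ring A] [Algebra k A]
    (g G x y : A) : A ⊗[k] A :=
  signedCommutator (-1 : k) x (signedCommutator (1 : k) y (kleinAverage g G 1))

theorem IsKleinPair.smul_one_sub_mem_tensorCentralizer (hgG : IsKleinPair g G) {ε : k}
    (hε : ε * ε = 1) (r : k) :
    r • (1 - g * G) ∈ tensorCentralizer (kleinAverage g G ε) :=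
  Subalgebra.smul_mem _ (sub_mem (one_mem _) <| mul_mem_tensorCentralizer hε
    (hgG.signedCommutator_left_kleinAverage hε) (hgG.signedCommutator_right_kleinAverage hε)) r

theorem isCasimir_oddCasimir {y : A} {r : k} (hgG : IsKleinPair g G) (hy : IsOdd g G y)
    (hsq : y * y = r • (1 - g * G)) (hgen : Algebra.adjoin k {g, G, y} = ⊤) :
    IsCasimir (oddCasimir k g G y) := by
  have hε : (-1 : k) * -1 = 1 := by ring
  refine .of_adjoin_eq_top hgen ?_
  rintro a (rfl | rfl | rfl) <;>
    refine mem_tensorCentralizer_iff_signedCommutator.mpr ?_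
  · simpa [oddCasimir] using signedCommutator_of_anticomm hy.left
      (hgG.signedCommutator_left_kleinAverage hε) (-1 : k)
  · simpa [oddCasimir] using signedCommutator_of_anticomm hy.right
      (hgG.signedCommutator_right_kleinAverage hε) (-1 : k)
  · rw [oddCasimir, signedCommutator_signedCommutator_neg (one_mul 1), hsq,
      ← mem_tensorCentralizer_iff_signedCommutator]
    exact hgG.smul_one_sub_mem_tensorCentralizer hε r

theorem oddBracket_self {y : A} (hy : y * y ∈ tensorCentralizer (kleinAverage g G (1 : k))) :
    oddBracket k g G y y = 0 := by
  have h := signedCommutator_signedCommutator_neg (ε := (-1 : k)) (by ring) y (kleinAverage g G 1)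
  rwa [neg_neg, mem_tensorCentralizer_iff_signedCommutator.mp hy] at h

theorem oddBracket_linear_combination (x y : A) (α β γ δ : k) :
    oddBracket k g G (α • x + β • y) (γ • x + δ • y) =
      (α * γ) • oddBracket k g G x x + (α * δ) • oddBracket k g G x y +
        (β * γ) • oddBracket k g G y x + (β * δ) • oddBracket k g G y y := by
  simp only [oddBracket, map_add, map_smul, LinearMap.add_apply, LinearMap.smul_apply]
  module

theorem signedCommutator_left_oddBracket {x y : A} (hgG : IsKleinPair g G) (hx : IsOdd g G x)
    (hy : IsOdd g G y) :
    signedCommutator (1 : k) g (oddBracket k g G x y) = 0 := by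
  simpa [oddBracket] using signedCommutator_of_anticomm hx.left (signedCommutator_of_anticomm
    hy.left (hgG.signedCommutator_left_kleinAverage (one_mul 1)) (1 : k)) (-1 : k)

theorem signedCommutator_right_oddBracket {x y : A} (hgG : IsKleinPair g G) (hx : IsOdd g G x)
    (hy : IsOdd g G y) :
    signedCommutator (1 : k) G (oddBracket k g G x y) = 0 := by
  simpa [oddBracket] using signedCommutator_of_anticomm hx.right (signedCommutator_of_anticomm
    hy.right (hgG.signedCommutator_right_kleinAverage (one_mul 1)) (1 : k)) (-1 : k)

theorem signedCommutator_oddBracket {x : A} (hx : x * x = 0) (y : A) :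
    signedCommutator (1 : k) x (oddBracket k g G x y) = 0 := by
  rw [oddBracket, signedCommutator_signedCommutator_neg (one_mul 1), hx, map_zero,
    LinearMap.zero_apply]

end OddCasimir

section Contraction

variable {k A : Type*} [CommRing k] [Ring A] [Algebra k A]
variable {M N : Type*}
  [AddCommGroup M] [Module k M] [Module A M]
  [AddCommGroup N] [Module k N] [Module A N]

/-- The action of `y` on `M` has a `k`-linear contracting homotopy. When `y²` acts as zero this says
that `y` acts as an exact differential. -/
def HasContraction (k : Type*) {A : Type*} [CommRing k] [Ring A] (y : A) (M : Type*)
    [AddCommGroup M] [Module k M] [Module A M] : Prop :=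
  ∃ h : M →ₗ[k] M, ∀ m, y • h m + h (y • m) = m

theorem HasUnitTrace.hasContraction [IsScalarTower k A M] {y : A} {T : A ⊗[k] A}
    (hM : HasUnitTrace (signedCommutator (-1 : k) y T) M) : HasContraction k y M := by
  obtain ⟨t, ht⟩ := hM
  refine ⟨sandwich T t, fun m => ?_⟩
  have h := sandwich_signedCommutator (-1 : k) y T t m
  rwa [ht, LinearMap.id_apply, neg_smul, one_smul, sub_neg_eq_add, eq_comm] at h

namespace HasContraction

variable {y : A}

theorem of_retract [IsScalarTower k A M] [IsScalarTower k A N] (hM : HasContraction k y M)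
    (i : N →ₗ[A] M) (r : M →ₗ[A] N) (hri : r ∘ₗ i = LinearMap.id) : HasContraction k y N := by
  obtain ⟨h, hh⟩ := hM
  refine ⟨r.restrictScalars k ∘ₗ h ∘ₗ i.restrictScalars k, fun n => ?_⟩
  calc y • r (h (i n)) + r (h (i (y • n)))
      = r (y • h (i n) + h (y • i n)) := by rw [map_add, map_smul r, map_smul i]
    _ = n := by rw [hh]; exact LinearMap.congr_fun hri n

omit [Algebra k A] in
theorem exists_smul_eq (hM : HasContraction k y M) {m : M} (hm : y • m = 0) : ∃ n, y • n = m := by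
  obtain ⟨h, hh⟩ := hM
  exact ⟨h m, by simpa [hm] using hh m⟩

end HasContraction

theorem inv_four_mul_four {k : Type*} [Field k] [NeZero (2 : k)] : (4⁻¹ : k) * 4 = 1 := by
  have h : (4 : k) ≠ 0 := by
    rw [show (4 : k) = 2 * 2 by norm_num]
    exact mul_ne_zero two_ne_zero two_ne_zero
  exact inv_mul_cancel₀ h

theorem HasContraction.hasUnitTrace {k A M : Type*} [Field k] [NeZero (2 : k)] [Ring A]
    [Algebra k A] [AddCommGroup M] [Module k M] [Module A M] [IsScalarTower k A M] {g G y : A}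
    (hgG : IsKleinPair g G) (hy : IsOdd g G y)
    (hM : HasContraction k y M) : HasUnitTrace (oddCasimir k g G y) M := by
  obtain ⟨h, hh⟩ := hM
  have hyh : Algebra.lsmul k k M y ∘ₗ h + h ∘ₗ Algebra.lsmul k k M y = LinearMap.id :=
    LinearMap.ext hh
  refine ⟨(4⁻¹ : k) • h, ?_⟩
  calc sandwich (oddCasimir k g G y) ((4⁻¹ : k) • h)
      = (4⁻¹ : k) • sandwich (kleinAverage g G 1)
          (Algebra.lsmul k k M y ∘ₗ h + h ∘ₗ Algebra.lsmul k k M y) := by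
        rw [oddCasimir, signedCommutator_apply, hy.tmul_one_mul_kleinAverage,
          hy.one_tmul_mul_kleinAverage, neg_one_smul, sub_neg_eq_add, map_smul, map_add,
          LinearMap.add_apply, sandwich_mul_tmul_one, sandwich_one_tmul_mul, map_add]
    _ = LinearMap.id := by
        rw [hyh, hgG.sandwich_kleinAverage (fun _ => rfl) (fun _ => rfl), smul_smul,
          inv_four_mul_four, one_smul]

end Contraction

namespace DTaft

section Relations

variable (k : Type u) [Field k]

theorem isKleinPair_gen : IsKleinPair (gen k .g) (gen k .G) where
  sq_left := by simpa [gen, sq] using RingQuot.mkAlgHom_rel k (Rel.g_sq (k := k))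
  sq_right := by simpa [gen, sq] using RingQuot.mkAlgHom_rel k (Rel.G_sq (k := k))
  comm := by simpa [gen] using RingQuot.mkAlgHom_rel k (Rel.g_G (k := k))

theorem isOdd_gen_x : IsOdd (gen k .g) (gen k .G) (gen k .x) where
  left := by simpa [gen] using RingQuot.mkAlgHom_rel k (Rel.g_x (k := k))
  right := by simpa [gen] using RingQuot.mkAlgHom_rel k (Rel.G_x (k := k))

theorem isOdd_gen_X : IsOdd (gen k .g) (gen k .G) (gen k .X) where
  left := by simpa [gen] using RingQuot.mkAlgHom_rel k (Rel.g_X (k := k))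
  right := by simpa [gen] using RingQuot.mkAlgHom_rel k (Rel.G_X (k := k))

theorem gen_x_mul_self : gen k .x * gen k .x = 0 := by
  simpa [gen, sq] using RingQuot.mkAlgHom_rel k (Rel.x_sq (k := k))

theorem gen_X_mul_self : gen k .X * gen k .X = 0 := by
  simpa [gen, sq] using RingQuot.mkAlgHom_rel k (Rel.X_sq (k := k))

theorem gen_x_mul_X_add : gen k .x * gen k .X + gen k .X * gen k .x = 1 - gen k .g * gen k .G := by
  simpa [gen] using RingQuot.mkAlgHom_rel k (Rel.x_X (k := k))

theorem adjoin_range_gen : Algebra.adjoin k (Set.range (gen k)) = ⊤ := by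
  have h : gen k = RingQuot.mkAlgHom k (Rel k) ∘ FreeAlgebra.ι k := rfl
  rw [h, Set.range_comp, ← AlgHom.map_adjoin, FreeAlgebra.adjoin_range_ι, Algebra.map_top,
    AlgHom.range_eq_top]
  exact RingQuot.mkAlgHom_surjective k (Rel k)

/-- The element `αx + βX`, the third generator of `H_{αβ}`. -/
noncomputable def pencil (α β : k) : D k :=
  α • gen k .x + β • gen k .X

theorem pencil_one_zero : pencil k 1 0 = gen k .x := by
  simp [pencil]

theorem pencil_zero_one : pencil k 0 1 = gen k .X := by
  simp [pencil]

theorem isOdd_pencil (α β : k) : IsOdd (gen k .g) (gen k .G) (pencil k α β) :=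
  (isOdd_gen_x k).linear_combination (isOdd_gen_X k) α β

theorem pencil_mul_self (α β : k) :
    pencil k α β * pencil k α β = (α * β) • (1 - gen k .g * gen k .G) := by
  simp only [pencil, mul_add, add_mul, smul_mul_smul_comm, gen_x_mul_self, gen_X_mul_self,
    smul_zero, add_zero, mul_comm β α, ← smul_add, ← gen_x_mul_X_add, add_comm]

end Relations

section DoubleCasimir

variable (k : Type u) [Field k]

/-- The Casimir element of `D(Λ₂)` attached to the basis `x`, `X` of the odd pencil. -/
noncomputable def casimir : D k ⊗[k] D k :=
  oddBracket k (gen k .g) (gen k .G) (gen k .x) (gen k .X)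

theorem oddBracket_pencil (α β γ δ : k) :
    oddBracket k (gen k .g) (gen k .G) (pencil k α β) (pencil k γ δ) =
      (α * δ - β * γ) • casimir k := by
  have self_eq_zero (α β : k) :
      oddBracket k (gen k .g) (gen k .G) (pencil k α β) (pencil k α β) = 0 :=
    oddBracket_self <| pencil_mul_self k α β ▸
      (isKleinPair_gen k).smul_one_sub_mem_tensorCentralizer (one_mul 1) (α * β)
  have hx := self_eq_zero 1 0
  have hX := self_eq_zero 0 1
  have hxX := self_eq_zero 1 1
  rw [pencil_one_zero] at hx
  rw [pencil_zero_one] at hX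
  rw [pencil, oddBracket_linear_combination, hx, hX] at hxX
  simp only [mul_one, one_smul, zero_add, smul_zero, add_zero] at hxX
  rw [pencil, pencil, oddBracket_linear_combination, hx, hX, eq_neg_of_add_eq_zero_right hxX,
    casimir]
  module

theorem isCasimir_casimir : IsCasimir (casimir k) := by
  refine .of_adjoin_eq_top (adjoin_range_gen k) ?_
  rintro _ ⟨a, rfl⟩
  refine mem_tensorCentralizer_iff_signedCommutator.mpr ?_
  have hswap : casimir k = -oddBracket k (gen k .g) (gen k .G) (gen k .X) (gen k .x) := by
    have h := oddBracket_pencil k 0 1 1 0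
    rw [pencil_zero_one, pencil_one_zero] at h
    rw [h]
    module
  cases a
  · exact signedCommutator_oddBracket (gen_x_mul_self k) _
  · rw [hswap, map_neg, signedCommutator_oddBracket (gen_X_mul_self k), neg_zero]
  · exact signedCommutator_left_oddBracket (isKleinPair_gen k) (isOdd_gen_x k) (isOdd_gen_X k)
  · exact signedCommutator_right_oddBracket (isKleinPair_gen k) (isOdd_gen_x k) (isOdd_gen_X k)

variable {k} {M : Type*} [AddCommGroup M] [Module k M] [Module (D k) M] [IsScalarTower k (D k) M]

theorem hasContraction_pencil (hM : HasUnitTrace (casimir k) M) {α β : k} (h : (α, β) ≠ (0, 0)) :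
    HasContraction k (pencil k α β) M := by
  obtain ⟨γ, δ, hdet⟩ : ∃ γ δ : k, α * δ - β * γ = 1 := by
    by_cases hα : α = 0
    · have hβ : β ≠ 0 := fun hβ => h (by rw [hα, hβ])
      exact ⟨-β⁻¹, 0, by simp [hβ]⟩
    · exact ⟨0, α⁻¹, by simp [hα]⟩
  have hcas := oddBracket_pencil k α β γ δ
  rw [hdet, one_smul] at hcas
  exact HasUnitTrace.hasContraction (hcas ▸ hM)

end DoubleCasimir

section Subalgebras

variable (k : Type u) [Field k] (α β : k)

/-- The generator `g` of `H_{αβ}`. -/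
noncomputable def H.g : H k α β :=
  ⟨gen k .g, Algebra.subset_adjoin (by simp)⟩

/-- The generator `G` of `H_{αβ}`. -/
noncomputable def H.G : H k α β :=
  ⟨gen k .G, Algebra.subset_adjoin (by simp)⟩

/-- The generator `αx + βX` of `H_{αβ}`. -/
noncomputable def H.y : H k α β :=
  ⟨pencil k α β, Algebra.subset_adjoin (by simp [pencil])⟩

theorem H.isKleinPair : IsKleinPair (H.g k α β) (H.G k α β) where
  sq_left := Subtype.ext (isKleinPair_gen k).sq_left
  sq_right := Subtype.ext (isKleinPair_gen k).sq_right
  comm := Subtype.ext (isKleinPair_gen k).comm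

theorem H.isOdd : IsOdd (H.g k α β) (H.G k α β) (H.y k α β) where
  left := Subtype.ext (isOdd_pencil k α β).left
  right := Subtype.ext (isOdd_pencil k α β).right

theorem H.adjoin_eq_top :
    Algebra.adjoin k ({H.g k α β, H.G k α β, H.y k α β} : Set (H k α β)) = ⊤ := by
  have h : ({H.g k α β, H.G k α β, H.y k α β} : Set (H k α β)) =
      ((↑) : H k α β → D k) ⁻¹' {gen k .g, gen k .G, pencil k α β} := by
    ext a
    simp only [Set.mem_insert_iff, Set.mem_singleton_iff, Set.mem_preimage, Subtype.ext_iff]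
    rfl
  rw [h]
  exact Algebra.adjoin_adjoin_coe_preimage

theorem H.isCasimir : IsCasimir (oddCasimir k (H.g k α β) (H.G k α β) (H.y k α β)) :=
  isCasimir_oddCasimir (H.isKleinPair k α β) (H.isOdd k α β)
    (Subtype.ext (pencil_mul_self k α β)) (H.adjoin_eq_top k α β)

variable {k α β} {M : Type*} [AddCommGroup M] [Module k M] [Module (D k) M]
  [IsScalarTower k (D k) M] [NeZero (2 : k)]

theorem H.hasUnitTrace (hM : HasContraction k (pencil k α β) M) :
    HasUnitTrace (oddCasimir k (H.g k α β) (H.G k α β) (H.y k α β)) M :=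
  HasContraction.hasUnitTrace (H.isKleinPair k α β) (H.isOdd k α β) hM

end Subalgebras

end DTaft

section LinearOverGenerators

variable {k A M N : Type*} [CommSemiring k] [Semiring A] [Algebra k A]
  [AddCommMonoid M] [Module k M] [Module A M] [IsScalarTower k A M]
  [AddCommMonoid N] [Module k N] [Module A N] [IsScalarTower k A N]

/-- A `k`-linear map which commutes with generators of `A`, as an `A`-linear map. -/
def linearMapOfAdjoin {s : Set A} (hs : Algebra.adjoin k s = ⊤) (f : M →ₗ[k] N)
    (hf : ∀ a ∈ s, ∀ m, f (a • m) = a • f m) : M →ₗ[A] N where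
  __ := f
  map_smul' a m := by
    have ha : a ∈ Algebra.adjoin k s := hs ▸ Algebra.mem_top
    change f (a • m) = a • f m
    induction ha using Algebra.adjoin_induction generalizing m with
    | mem a h => exact hf a h m
    | algebraMap c => simp [algebraMap_smul]
    | add a b _ _ iha ihb => simp [add_smul, iha, ihb]
    | mul a b _ _ iha ihb => simp [mul_smul, iha, ihb]

end LinearOverGenerators

section DualOperators

variable {k A : Type*} [Field k] [Ring A] [Algebra k A]
variable {M : Type*} [AddCommGroup M] [Module k M] [Module A M]

/-- The operator `s` anticommutes with the actions of `g` and of `G`. -/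
structure IsOddOperator (g G : A) (s : M →ₗ[k] M) : Prop where
  left (m : M) : s (g • m) = -(g • s m)
  right (m : M) : s (G • m) = -(G • s m)

theorem HasUnitTrace.of_dual_operators [NeZero (2 : k)] [IsScalarTower k A M] {g G x y : A}
    (hgG : IsKleinPair g G) {s t : M →ₗ[k] M} (hs : IsOddOperator g G s) (ht : IsOddOperator g G t)
    (hxs : ∀ m, x • s m + s (x • m) = m) (hys : ∀ m, y • s m + s (y • m) = 0)
    (hyt : ∀ m, y • t m + t (y • m) = m) : HasUnitTrace (oddBracket k g G x y) M := by
  have htrace : sandwich (kleinAverage g G 1) ((4⁻¹ : k) • t ∘ₗ s) = t ∘ₗ s := by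
    rw [map_smul, hgG.sandwich_kleinAverage (fun m => by simp [hs.left, ht.left])
      (fun m => by simp [hs.right, ht.right]), smul_smul, inv_four_mul_four, one_smul]
  have hinner : sandwich (signedCommutator 1 y (kleinAverage g G 1)) ((4⁻¹ : k) • t ∘ₗ s) = s := by
    ext m
    rw [sandwich_signedCommutator, htrace, one_smul]
    calc y • t (s m) - t (s (y • m))
        = (y • t (s m) + t (y • s m)) - t (y • s m + s (y • m)) := by rw [map_add]; abel
      _ = s m := by rw [hyt, hys, map_zero, sub_zero]
  refine ⟨(4⁻¹ : k) • t ∘ₗ s, LinearMap.ext fun m => ?_⟩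
  rw [oddBracket, sandwich_signedCommutator, hinner, neg_one_smul, sub_neg_eq_add, hxs,
    LinearMap.id_apply]

end DualOperators

namespace DTaft

section ConeHom

/-- The matrices by which the generators act on `Cone α β M`, where `e a` is the action on `M` of
the generator `a`. -/
def coneMatrix {k A : Type*} [Field k] [Ring A] [Algebra k A] (α β : k) (e : Gen → A) :
    Gen → Matrix (Fin 2) (Fin 2) A
  | .x => !![e .x, 0; α • e .g, e .x]
  | .X => !![e .X, 0; β • e .g, e .X]
  | .g => !![e .g, 0; 0, -e .g]
  | .G => !![e .G, 0; 0, -e .G]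

theorem lift_coneMatrix_rel {k : Type u} {A : Type*} [Field k] [Ring A] [Algebra k A] (α β : k)
    {e : Gen → A} (hgG : IsKleinPair (e .g) (e .G)) (hx : IsOdd (e .g) (e .G) (e .x))
    (hX : IsOdd (e .g) (e .G) (e .X)) (hxx : e .x * e .x = 0) (hXX : e .X * e .X = 0)
    (hxX : e .x * e .X + e .X * e .x = 1 - e .g * e .G) {a b : FreeAlgebra k Gen} (h : Rel k a b) :
    FreeAlgebra.lift k (coneMatrix α β e) a = FreeAlgebra.lift k (coneMatrix α β e) b := by
  have hXx := eq_sub_of_add_eq' hxX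
  cases h <;>
    simp only [fr, sq, map_mul, map_add, map_sub, map_neg, map_zero, map_one,
      FreeAlgebra.lift_ι_apply] <;>
    simp [coneMatrix, Matrix.one_fin_two, ← Matrix.ext_iff, Fin.forall_fin_two, hXx, hxx, hXX,
      hgG.sq_left, hgG.sq_right, ← hgG.comm, hx.left, hx.right, hX.left, hX.right]

variable (k : Type u) [Field k] (α β : k)

/-- The algebra homomorphism given by `coneMatrix`. -/
noncomputable def coneHom : D k →ₐ[k] Matrix (Fin 2) (Fin 2) (D k) :=
  RingQuot.liftAlgHom k
    ⟨FreeAlgebra.lift k (coneMatrix α β (gen k)), fun _ _ => lift_coneMatrix_rel α β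
      (isKleinPair_gen k) (isOdd_gen_x k) (isOdd_gen_X k) (gen_x_mul_self k) (gen_X_mul_self k)
      (gen_x_mul_X_add k)⟩

theorem coneHom_gen (a : Gen) : coneHom k α β (gen k a) = coneMatrix α β (gen k) a := by
  simp [coneHom, gen]

end ConeHom

/-- The extension of `M` by a copy of `M` with reversed parity in which `x` and `X`, besides acting
on both copies, map the first one to the second by `αg` and `βg`. -/
@[nolint unusedArguments]
def Cone {k : Type*} (_ _ : k) (M : Type*) : Type _ :=
  Fin 2 → M

namespace Cone

/-- The element of the cone with the given components. -/
def mk {k M : Type*} {α β : k} (a b : M) : Cone α β M :=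
  ![a, b]

@[simp]
theorem mk_apply_zero {k M : Type*} {α β : k} (a b : M) : (mk a b : Cone α β M) 0 = a :=
  rfl

@[simp]
theorem mk_apply_one {k M : Type*} {α β : k} (a b : M) : (mk a b : Cone α β M) 1 = b :=
  rfl

@[ext]
theorem ext {k M : Type*} {α β : k} {v w : Cone α β M} (h₀ : v 0 = w 0) (h₁ : v 1 = w 1) : v = w :=
  funext <| Fin.forall_fin_two.mpr ⟨h₀, h₁⟩

section Additive

variable {k M : Type*} {α β : k} [AddCommGroup M]

instance : AddCommGroup (Cone α β M) :=
  inferInstanceAs (AddCommGroup (Fin 2 → M))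

@[simp]
theorem zero_apply (i : Fin 2) : (0 : Cone α β M) i = 0 :=
  rfl

@[simp]
theorem add_apply (v w : Cone α β M) (i : Fin 2) : (v + w) i = v i + w i :=
  rfl

@[simp]
theorem neg_apply (v : Cone α β M) (i : Fin 2) : (-v) i = -v i :=
  rfl

end Additive

section Linear

variable {k M : Type*} {α β : k} [Field k] [AddCommGroup M] [Module k M]

instance : Module k (Cone α β M) :=
  inferInstanceAs (Module k (Fin 2 → M))

instance [FiniteDimensional k M] : FiniteDimensional k (Cone α β M) :=
  inferInstanceAs (FiniteDimensional k (Fin 2 → M))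

@[simp]
theorem smul_apply (c : k) (v : Cone α β M) (i : Fin 2) : (c • v) i = c • v i :=
  rfl

/-- The componentwise action of a linear map on the cone. -/
def map (s : M →ₗ[k] M) : Cone α β M →ₗ[k] Cone α β M :=
  s.compLeft (Fin 2)

@[simp]
theorem map_apply (s : M →ₗ[k] M) (v : Cone α β M) (i : Fin 2) : map s v i = s (v i) :=
  rfl

end Linear

section Action

variable {k : Type u} {M : Type*} [Field k] {α β : k} [AddCommGroup M] [Module (D k) M]

open scoped Matrix.Module in
noncomputable instance : Module (D k) (Cone α β M) :=
  Module.compHom (Fin 2 → M) (coneHom k α β).toRingHom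

theorem algebra_smul_apply (a : D k) (v : Cone α β M) (i : Fin 2) :
    (a • v) i = coneHom k α β a i 0 • v 0 + coneHom k α β a i 1 • v 1 :=
  Fin.sum_univ_two _

theorem gen_smul_apply (a : Gen) (v : Cone α β M) (i : Fin 2) : (gen k a • v) i =
    coneMatrix α β (gen k) a i 0 • v 0 + coneMatrix α β (gen k) a i 1 • v 1 := by
  rw [algebra_smul_apply, coneHom_gen]

variable [Module k M] [IsScalarTower k (D k) M]

instance : IsScalarTower k (D k) (Cone α β M) :=
  .of_algebraMap_smul fun c v => by
    ext <;> simp [algebra_smul_apply, Matrix.algebraMap_eq_diagonal]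

/-- The projection to the first copy of `M`. -/
noncomputable def fst : Cone α β M →ₗ[D k] M :=
  linearMapOfAdjoin (k := k) (adjoin_range_gen k)
    { toFun := fun v => v 0, map_add' := fun _ _ => rfl, map_smul' := fun _ _ => rfl } <| by
    rintro _ ⟨a, rfl⟩ v
    refine (gen_smul_apply a v 0).trans ?_
    change _ = gen k a • v 0
    cases a <;> simp [coneMatrix]

/-- Up to the action of `g`, the projection to the second copy of `M` followed by the inclusion of
the first one. -/
noncomputable def shift : Cone α β M →ₗ[k] Cone α β M where
  toFun v := mk (gen k .g • v 1) 0
  map_add' v w := by ext <;> simp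
  map_smul' c v := by ext <;> simp [smul_comm _ c]

theorem shift_apply (v : Cone α β M) : shift v = mk (gen k .g • v 1) 0 :=
  rfl

theorem isOddOperator_shift :
    IsOddOperator (gen k .g) (gen k .G) (shift : Cone α β M →ₗ[k] Cone α β M) where
  left v := by
    ext <;> simp [shift_apply, gen_smul_apply, coneMatrix]
  right v := by
    ext <;> simp [shift_apply, gen_smul_apply, coneMatrix, smul_smul, (isKleinPair_gen k).comm]

theorem pencil_smul (γ δ : k) (v : Cone α β M) : pencil k γ δ • v =
    mk (pencil k γ δ • v 0) ((γ * α + δ * β) • gen k .g • v 0 + pencil k γ δ • v 1) := by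
  ext <;> simp [pencil, add_smul, mul_smul, gen_smul_apply, coneMatrix]
  abel

theorem pencil_smul_shift_add (γ δ : k) (v : Cone α β M) :
    pencil k γ δ • shift v + shift (pencil k γ δ • v) = (γ * α + δ * β) • v := by
  ext <;> simp only [pencil_smul, shift_apply, add_apply, smul_apply, mk_apply_zero, mk_apply_one]
  · rw [smul_add, (isOdd_pencil k γ δ).left_smul, smul_comm (gen k .g) (_ : k),
      smul_smul (gen k .g), (isKleinPair_gen k).sq_left, one_smul]
    abel
  · rw [smul_smul (gen k .g), (isKleinPair_gen k).sq_left, one_smul, smul_zero, add_zero, add_zero]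

section Map

variable {s : M →ₗ[k] M} (hs : IsOddOperator (gen k .g) (gen k .G) s) {c : k}
include hs

omit [IsScalarTower k (D k) M] in
theorem isOddOperator_map :
    IsOddOperator (gen k .g) (gen k .G) (map s : Cone α β M →ₗ[k] Cone α β M) where
  left v := by ext <;> simp [gen_smul_apply, coneMatrix, hs.left]
  right v := by ext <;> simp [gen_smul_apply, coneMatrix, hs.right]

theorem pencil_smul_map_add {γ δ : k}
    (hs' : ∀ m, pencil k γ δ • s m + s (pencil k γ δ • m) = c • m) (v : Cone α β M) :
    pencil k γ δ • map s v + map s (pencil k γ δ • v) = c • v := by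
  ext <;> simp only [pencil_smul, map_apply, add_apply, smul_apply, mk_apply_zero, mk_apply_one,
    map_add, map_smul, ← hs', hs.left, smul_neg]
  abel

end Map

end Action

end Cone

section Envelope

/-- An extension of `M` through which each homomorphism `M → I` into an injective module and each
homomorphism `P → M` from a projective module factors: the tensor product of `M` with the exterior
algebra on two odd variables. -/
abbrev Envelope (k : Type*) [Field k] (M : Type*) : Type _ :=
  Cone (0 : k) 1 (Cone (1 : k) 0 M)

namespace Envelope

variable (k : Type u) (M : Type*) [Field k] [AddCommGroup M] [Module k M] [Module (D k) M]
  [IsScalarTower k (D k) M]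

/-- The projection to the first copy of `M`. -/
noncomputable def proj : Envelope k M →ₗ[D k] M :=
  Cone.fst ∘ₗ Cone.fst

theorem proj_surjective : Function.Surjective (proj k M) :=
  fun m => ⟨Cone.mk (Cone.mk m 0) 0, rfl⟩

/-- The inclusion of the last copy of `M`, which has the same parity as the first one. -/
noncomputable def incl : M →ₗ[D k] Envelope k M :=
  linearMapOfAdjoin (k := k) (adjoin_range_gen k)
    { toFun := fun m => Cone.mk 0 (Cone.mk 0 m)
      map_add' := fun m n => by ext <;> simp
      map_smul' := fun c m => by ext <;> simp } <| by
    rintro _ ⟨a, rfl⟩ m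
    cases a <;> ext <;> simp [Cone.gen_smul_apply, coneMatrix]

theorem incl_injective : Function.Injective (incl k M) :=
  fun _ _ h => congrArg (fun v : Envelope k M => v 1 1) h

theorem hasUnitTrace [NeZero (2 : k)] : HasUnitTrace (casimir k) (Envelope k M) := by
  have h := fun γ δ : k => Cone.pencil_smul_map_add (α := (0 : k)) (β := 1)
    (Cone.isOddOperator_shift (M := M) (α := (1 : k)) (β := 0)) (Cone.pencil_smul_shift_add γ δ)
  refine .of_dual_operators (isKleinPair_gen k) (Cone.isOddOperator_map Cone.isOddOperator_shift)
    Cone.isOddOperator_shift (fun v => ?_) (fun v => ?_) (fun v => ?_)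
  · simpa [pencil_one_zero] using h 1 0 v
  · simpa [pencil_zero_one] using h 0 1 v
  · simpa [pencil_zero_one] using Cone.pencil_smul_shift_add 0 1 v

end Envelope

end Envelope

section Criteria

variable {k : Type u} [Field k] [NeZero (2 : k)]

theorem projective_iff_hasUnitTrace {M : Type*} [AddCommGroup M] [Module k M] [Module (D k) M]
    [IsScalarTower k (D k) M] : Module.Projective (D k) M ↔ HasUnitTrace (casimir k) M := by
  refine ⟨fun hM => ?_, fun hM => hM.projective (isCasimir_casimir k)⟩
  obtain ⟨s, hs⟩ := Module.projective_lifting_property (Envelope.proj k M) LinearMap.id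
    (Envelope.proj_surjective k M)
  exact (Envelope.hasUnitTrace k M).of_retract s (Envelope.proj k M) hs

theorem injective_iff_hasUnitTrace {M : Type u} [AddCommGroup M] [Module k M] [Module (D k) M]
    [IsScalarTower k (D k) M] : Module.Injective (D k) M ↔ HasUnitTrace (casimir k) M := by
  refine ⟨fun hM => ?_, fun hM => hM.injective (isCasimir_casimir k)⟩
  obtain ⟨r, hr⟩ := hM.out (Envelope.incl k M) (Envelope.incl_injective k M) LinearMap.id
  exact (Envelope.hasUnitTrace k M).of_retract (Envelope.incl k M) r (LinearMap.ext hr)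

theorem H.projective_iff_hasContraction {M : Type*} [AddCommGroup M] [Module k M] [Module (D k) M]
    [IsScalarTower k (D k) M] {α β : k} (h : (α, β) ≠ (0, 0)) :
    Module.Projective (H k α β) M ↔ HasContraction k (pencil k α β) M := by
  refine ⟨fun hM => ?_, fun hM => (H.hasUnitTrace hM).projective (H.isCasimir k α β)⟩
  obtain ⟨s, hs⟩ := Module.projective_lifting_property
    ((Envelope.proj k M).restrictScalars (H k α β)) LinearMap.id (Envelope.proj_surjective k M)
  have hE : HasContraction k (H.y k α β) (Envelope k M) :=
    hasContraction_pencil (Envelope.hasUnitTrace k M) h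
  exact hE.of_retract s _ hs

end Criteria

end DTaft

section LinearAlgebra

variable {k V : Type*} [Field k] [AddCommGroup V] [Module k V]

theorem exists_comp_comp_eq_self {k V W : Type*} [DivisionRing k] [AddCommGroup V] [Module k V]
    [AddCommGroup W] [Module k W] (p : V →ₗ[k] W) : ∃ t : W →ₗ[k] V, p ∘ₗ t ∘ₗ p = p := by
  obtain ⟨s, hs⟩ := p.rangeRestrict.exists_rightInverse_of_surjective p.range_rangeRestrict
  obtain ⟨t, ht⟩ := s.exists_extend
  refine ⟨t, LinearMap.ext fun v => ?_⟩
  have htp : t (p v) = s (p.rangeRestrict v) := LinearMap.congr_fun ht (p.rangeRestrict v)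
  calc p (t (p v)) = p.rangeRestrict (s (p.rangeRestrict v)) := by rw [htp]; rfl
    _ = p v := congrArg Subtype.val (LinearMap.congr_fun hs (p.rangeRestrict v))

theorem exists_eigenvector_modulo [IsAlgClosed k] [FiniteDimensional k V] (T : Module.End k V)
    {K W : Submodule k V} (hK : K ≤ K.comap T) (hW : W ≤ W.comap T) (hKW : ¬ K ≤ W) :
    ∃ (c : k) (v : V), v ∈ K ∧ v ∉ W ∧ T v - c • v ∈ W := by
  have _ : Nontrivial (K ⧸ W.submoduleOf K) :=
    Submodule.Quotient.nontrivial_iff.mpr fun h => hKW (Submodule.submoduleOf_eq_top.mp h)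
  obtain ⟨c, hc⟩ := Module.End.exists_eigenvalue
    ((W.submoduleOf K).mapQ (W.submoduleOf K) (T.restrict hK) fun _ hv => hW hv)
  obtain ⟨v, hv⟩ := hc.exists_hasEigenvector
  obtain ⟨v, rfl⟩ := Submodule.Quotient.mk_surjective _ v
  refine ⟨c, v, v.2, fun h => hv.2 ((Submodule.Quotient.mk_eq_zero _).mpr h), ?_⟩
  exact (Submodule.Quotient.eq (W.submoduleOf K) (x := T.restrict hK v) (y := c • v)).mp
    hv.apply_eq_smul

section ExteriorAction

variable {x X : Module.End k V} (hx : ∀ v, x (x v) = 0) (hX : ∀ v, X (X v) = 0)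
  (hxX : ∀ v, x (X v) + X (x v) = 0)
include hx hX hxX

theorem exists_lift_along_exact (hexact : LinearMap.ker x ≤ LinearMap.range x) :
    ∃ T : Module.End k V, (∀ v, x (X v) = 0 → x (T v) = X v) ∧
      LinearMap.range x ⊔ LinearMap.range X ≤
        (LinearMap.range x ⊔ LinearMap.range X).comap T := by
  obtain ⟨s, hs⟩ := exists_comp_comp_eq_self x
  let T : Module.End k V := s ∘ₗ X
  have x_T {v : V} (hv : x (X v) = 0) : x (T v) = X v := by
    obtain ⟨w, hw⟩ := hexact hv
    change x (s (X v)) = X v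
    rw [← hw]
    exact LinearMap.congr_fun hs w
  refine ⟨T, fun v => x_T, fun v hv => ?_⟩
  obtain ⟨_, ⟨a, rfl⟩, _, ⟨b, rfl⟩, rfl⟩ := Submodule.mem_sup.mp hv
  have hTX : T (X b) = 0 := (congrArg s (hX b)).trans (map_zero s)
  have hTx : x (T (x a) + X a) = 0 := by
    rw [map_add, x_T (by rw [eq_neg_of_add_eq_zero_left (hxX _), hx, map_zero, neg_zero]),
      add_comm, hxX]
  obtain ⟨w, hw⟩ := hexact hTx
  refine Submodule.mem_sup.mpr ⟨_, ⟨w, rfl⟩, _, ⟨-a, rfl⟩, ?_⟩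
  rw [hw, map_neg, add_neg_cancel_right, map_add, hTX, add_zero]

theorem ker_mul_le_range_sup_range [IsAlgClosed k] [FiniteDimensional k V]
    (hexact : ∀ α β : k, (α, β) ≠ (0, 0) →
      LinearMap.ker (α • x + β • X) ≤ LinearMap.range (α • x + β • X)) :
    LinearMap.ker (x * X) ≤ LinearMap.range x ⊔ LinearMap.range X := by
  obtain ⟨T, x_T, hW⟩ := exists_lift_along_exact hx hX hxX (by simpa using hexact 1 0 (by simp))
  have hK : LinearMap.ker (x * X) ≤ (LinearMap.ker (x * X)).comap T := fun v hv => by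
    change x (X (T v)) = 0
    rw [eq_neg_of_add_eq_zero_left (hxX _), x_T v hv, hX, neg_zero]
  by_contra hKW
  obtain ⟨c, v, hvK, hvW, hv⟩ := exists_eigenvector_modulo T hK hW hKW
  obtain ⟨_, ⟨a, rfl⟩, _, ⟨b, rfl⟩, hab⟩ := Submodule.mem_sup.mp hv
  have hker : (-c) • x (v + x b) + (1 : k) • X (v + x b) = 0 := by
    have hxab : x (X b) = X v - c • x v := by
      rw [← x_T v hvK, ← map_smul, ← map_sub, ← hab, map_add, hx, zero_add]
    rw [map_add, map_add, hx, add_zero, one_smul, eq_neg_of_add_eq_zero_right (hxX b), hxab]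
    module
  obtain ⟨w, hw : (-c) • x w + (1 : k) • X w = v + x b⟩ := hexact (-c) 1 (by simp) hker
  refine hvW (Submodule.mem_sup.mpr ⟨_, ⟨(-c) • w - b, rfl⟩, _, ⟨w, rfl⟩, ?_⟩)
  rw [eq_sub_of_add_eq hw.symm, one_smul, map_sub, map_smul]
  abel

end ExteriorAction

end LinearAlgebra

section Idempotents

variable {k A M : Type*} [Field k] [Ring A] [Algebra k A] [AddCommGroup M] [Module k M]
  [Module A M] {e : Module.End A M}

theorem rangeRestrict_comp_subtype (he : IsIdempotentElem e) :
    e.rangeRestrict ∘ₗ (LinearMap.range e).subtype = LinearMap.id :=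
  LinearMap.ext fun m => Subtype.ext ((LinearMap.IsIdempotentElem.mem_range_iff he).mp m.2)

variable [IsScalarTower k A M]

theorem HasUnitTrace.of_isIdempotentElem {T : A ⊗[k] A}
    (h : HasUnitTrace T (LinearMap.range e)) (h' : HasUnitTrace T (LinearMap.range (1 - e))) :
    HasUnitTrace T M :=
  h.of_add_eq_id h' (LinearMap.range e).subtype e.rangeRestrict
    (LinearMap.range (1 - e)).subtype (1 - e).rangeRestrict
    (LinearMap.ext fun m => add_sub_cancel (e m) m)

theorem HasContraction.range {y : A} (hM : HasContraction k y M) (he : IsIdempotentElem e) :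
    HasContraction k y (LinearMap.range e) :=
  hM.of_retract _ _ (rangeRestrict_comp_subtype he)

end Idempotents

namespace DTaft

section Parity

variable {k : Type u} [Field k] {M : Type*} [AddCommGroup M] [Module k M] [Module (D k) M]

omit [Module k M] in
theorem gen_x_smul_gen_X_smul_add (m : M) : gen k .x • gen k .X • m + gen k .X • gen k .x • m =
    m - (gen k .g * gen k .G) • m := by
  simp only [smul_smul, ← add_smul, gen_x_mul_X_add, sub_smul, one_smul]

theorem commute_gen_g_mul_gen_G (a : Gen) : Commute (gen k .g * gen k .G) (gen k a) := by
  have hcomm : Commute (gen k .g) (gen k .G) := (isKleinPair_gen k).comm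
  cases a
  · exact (isOdd_gen_x k).commute
  · exact (isOdd_gen_X k).commute
  · exact (Commute.refl _).mul_left hcomm.symm
  · exact hcomm.mul_left (Commute.refl _)

theorem sq_gen_g_mul_gen_G : (gen k .g * gen k .G) * (gen k .g * gen k .G) = 1 := by
  rw [mul_assoc, ← mul_assoc (gen k .G), ← (isKleinPair_gen k).comm,
    mul_assoc (gen k .g) (gen k .G), (isKleinPair_gen k).sq_right, mul_one,
    (isKleinPair_gen k).sq_left]

variable [IsScalarTower k (D k) M]

variable (k M) in
/-- The action of the central idempotent `(1 + gG) / 2`, which splits a module into the part on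
which `gG` acts as `1` and the part on which it acts as `-1`. -/
noncomputable def evenProj : Module.End (D k) M :=
  linearMapOfAdjoin (k := k) (adjoin_range_gen k)
    ((2⁻¹ : k) • (LinearMap.id + Algebra.lsmul k k M (gen k .g * gen k .G))) <| by
  rintro _ ⟨a, rfl⟩ m
  change (2⁻¹ : k) • (gen k a • m + (gen k .g * gen k .G) • gen k a • m) =
    gen k a • (2⁻¹ : k) • (m + (gen k .g * gen k .G) • m)
  rw [smul_comm (gen k a) (2⁻¹ : k), smul_add (gen k a), smul_smul,
    (commute_gen_g_mul_gen_G a).eq, mul_smul]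

theorem evenProj_apply (m : M) :
    evenProj k M m = (2⁻¹ : k) • (m + (gen k .g * gen k .G) • m) :=
  rfl

theorem gen_g_mul_gen_G_smul_evenProj (m : M) :
    (gen k .g * gen k .G) • evenProj k M m = evenProj k M m := by
  rw [evenProj_apply, smul_comm _ (2⁻¹ : k), smul_add, smul_smul (_ * _), sq_gen_g_mul_gen_G,
    one_smul, add_comm]

variable [NeZero (2 : k)]

theorem gen_g_mul_gen_G_smul_one_sub_evenProj (m : M) :
    (gen k .g * gen k .G) • (1 - evenProj k M) m = -(1 - evenProj k M) m := by
  have h : (2 : k) • evenProj k M m = m + (gen k .g * gen k .G) • m := by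
    rw [evenProj_apply, smul_smul, mul_inv_cancel₀ two_ne_zero, one_smul]
  rw [LinearMap.sub_apply, Module.End.one_apply, smul_sub, gen_g_mul_gen_G_smul_evenProj,
    eq_sub_of_add_eq' h.symm]
  module

theorem isIdempotentElem_evenProj : IsIdempotentElem (evenProj k M) := by
  refine LinearMap.ext fun m => ?_
  rw [Module.End.mul_apply, evenProj_apply, gen_g_mul_gen_G_smul_evenProj, ← two_smul k, smul_smul,
    inv_mul_cancel₀ two_ne_zero, one_smul]

end Parity

section Dade

variable {k : Type u} [Field k] {M : Type*} [AddCommGroup M] [Module k M]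
  [Module (D k) M] [IsScalarTower k (D k) M]

theorem isOddOperator_smul_lsmul {y : D k} (hy : IsOdd (gen k .g) (gen k .G) y) (c : k) :
    IsOddOperator (gen k .g) (gen k .G) (c • (Algebra.lsmul k k M y : M →ₗ[k] M)) where
  left m := by simp [smul_comm _ c, hy.left_smul]
  right m := by simp [smul_comm _ c, hy.right_smul]

theorem hasUnitTrace_of_odd [NeZero (2 : k)] (hM : ∀ m : M, (gen k .g * gen k .G) • m = -m) :
    HasUnitTrace (casimir k) M := by
  have hsum (m : M) :
      (2⁻¹ : k) • (gen k .x • gen k .X • m + gen k .X • gen k .x • m) = m := by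
    rw [gen_x_smul_gen_X_smul_add, hM, sub_neg_eq_add, ← two_smul k, smul_smul,
      inv_mul_cancel₀ two_ne_zero, one_smul]
  refine .of_dual_operators (isKleinPair_gen k)
    (isOddOperator_smul_lsmul (isOdd_gen_X k) 2⁻¹) (isOddOperator_smul_lsmul (isOdd_gen_x k) 2⁻¹)
    (fun m => ?_) (fun m => ?_) (fun m => ?_) <;>
    simp only [LinearMap.smul_apply, Algebra.lsmul_coe, smul_comm _ (2⁻¹ : k), ← smul_add]
  · exact hsum m
  · simp only [smul_smul (gen k .X), gen_X_mul_self, zero_smul, smul_zero]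
  · rw [add_comm, hsum]

section Even

variable (hM : ∀ m : M, (gen k .g * gen k .G) • m = m)
include hM

omit [Module k M] [IsScalarTower k (D k) M] in
theorem gen_X_smul_gen_x_smul_of_even (m : M) :
    gen k .X • gen k .x • m = -(gen k .x • gen k .X • m) := by
  rw [eq_neg_iff_add_eq_zero, add_comm, gen_x_smul_gen_X_smul_add, hM, sub_self]

omit [Module k M] [IsScalarTower k (D k) M] in
theorem gen_x_smul_gen_X_smul_gen_x_smul_of_even (m : M) :
    gen k .x • gen k .X • gen k .x • m = 0 := by
  rw [gen_X_smul_gen_x_smul_of_even hM, smul_neg, smul_smul, gen_x_mul_self, zero_smul, neg_zero]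

variable (k M) in
/-- The action of the socle element `xX` of the exterior algebra on a module on which `gG` acts as
`1`. -/
noncomputable def evenSocle : Module.End (D k) M :=
  linearMapOfAdjoin (k := k) (adjoin_range_gen k)
    (Algebra.lsmul k k M (gen k .x) ∘ₗ Algebra.lsmul k k M (gen k .X)) <| by
  rintro _ ⟨a, rfl⟩ m
  change gen k .x • gen k .X • gen k a • m = gen k a • gen k .x • gen k .X • m
  cases a
  · rw [gen_x_smul_gen_X_smul_gen_x_smul_of_even hM, smul_smul (gen k .x) (gen k .x),
      gen_x_mul_self, zero_smul]
  · rw [gen_X_smul_gen_x_smul_of_even hM, smul_smul (gen k .X) (gen k .X), gen_X_mul_self,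
      zero_smul, smul_zero, neg_zero]
  · rw [(isOdd_gen_x k).left_smul, (isOdd_gen_X k).left_smul, smul_neg, neg_neg]
  · rw [(isOdd_gen_x k).right_smul, (isOdd_gen_X k).right_smul, smul_neg, neg_neg]

theorem evenSocle_apply (m : M) : evenSocle k M hM m = gen k .x • gen k .X • m :=
  rfl

theorem evenSocle_gen_x_smul (m : M) : evenSocle k M hM (gen k .x • m) = 0 :=
  gen_x_smul_gen_X_smul_gen_x_smul_of_even hM m

theorem evenSocle_gen_X_smul (m : M) : evenSocle k M hM (gen k .X • m) = 0 := by
  rw [evenSocle_apply, smul_smul (gen k .X), gen_X_mul_self, zero_smul, smul_zero]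

theorem exists_evenSocle_mul_trace [NeZero (2 : k)] :
    ∃ t : M →ₗ[k] M, evenSocle k M hM * (isCasimir_casimir k).trace t = evenSocle k M hM := by
  let p : M →ₗ[k] M := (evenSocle k M hM).restrictScalars k
  obtain ⟨t, ht⟩ := exists_comp_comp_eq_self p
  let u : M →ₗ[k] M := sandwich (kleinAverage (gen k .g) (gen k .G) 1) ((4⁻¹ : k) • t)
  have hu : p ∘ₗ u ∘ₗ p = p := by
    rw [← sandwich_comp_restrictScalars, ← sandwich_restrictScalars_comp, LinearMap.smul_comp,
      LinearMap.comp_smul, ht, map_smul, (isKleinPair_gen k).sandwich_kleinAverage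
        (fun m => map_smul (evenSocle k M hM) _ m) (fun m => map_smul (evenSocle k M hM) _ m),
      smul_smul, inv_four_mul_four, one_smul]
  refine ⟨(4⁻¹ : k) • t, LinearMap.ext fun m => ?_⟩
  calc evenSocle k M hM ((isCasimir_casimir k).trace ((4⁻¹ : k) • t) m)
      = evenSocle k M hM (gen k .x • (gen k .X • u m - u (gen k .X • m)) +
          (gen k .X • u (gen k .x • m) - u (gen k .X • gen k .x • m))) := by
        rw [IsCasimir.trace_apply, casimir, oddBracket, sandwich_signedCommutator, neg_one_smul,
          sub_neg_eq_add, sandwich_signedCommutator, one_smul, sandwich_signedCommutator, one_smul]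
    _ = evenSocle k M hM (u (evenSocle k M hM m)) := by
        rw [map_add, map_sub, evenSocle_gen_x_smul, evenSocle_gen_X_smul,
          gen_X_smul_gen_x_smul_of_even hM, map_neg, map_neg, sub_neg_eq_add, zero_add, zero_add]
        rfl
    _ = evenSocle k M hM m := LinearMap.congr_fun hu m

theorem isNilpotent_of_evenSocle_mul_eq_zero
    (hker : ∀ m : M, gen k .x • gen k .X • m = 0 → ∃ a b : M, gen k .x • a + gen k .X • b = m)
    {n : Module.End (D k) M} (hn : evenSocle k M hM * n = 0) : IsNilpotent n := by
  refine ⟨3, LinearMap.ext fun m => ?_⟩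
  have exists_eq (m : M) : ∃ a b : M, gen k .x • a + gen k .X • b = n m :=
    hker (n m) (LinearMap.congr_fun hn m)
  obtain ⟨a, b, hab⟩ := exists_eq m
  obtain ⟨a₁, a₂, ha⟩ := exists_eq a
  obtain ⟨b₁, b₂, hb⟩ := exists_eq b
  have hnn : n (n m) = evenSocle k M hM (a₂ - b₁) := by
    rw [← hab, map_add, map_smul, map_smul, ← ha, ← hb, smul_add, smul_add,
      smul_smul (gen k .x) (gen k .x), smul_smul (gen k .X) (gen k .X), gen_x_mul_self,
      gen_X_mul_self, zero_smul, zero_smul, zero_add, add_zero,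
      gen_X_smul_gen_x_smul_of_even hM, ← sub_eq_add_neg, evenSocle_apply, smul_sub, smul_sub]
  calc n (n (n m)) = evenSocle k M hM (n (a₂ - b₁)) := by
        rw [hnn, evenSocle_apply, map_smul, map_smul, evenSocle_apply]
    _ = 0 := LinearMap.congr_fun hn _

variable [IsAlgClosed k] [FiniteDimensional k M]
  (hC : ∀ α β : k, (α, β) ≠ (0, 0) → HasContraction k (pencil k α β) M)
include hC

theorem exists_gen_smul_add_gen_smul_eq {m : M} (hm : gen k .x • gen k .X • m = 0) :
    ∃ a b : M, gen k .x • a + gen k .X • b = m := by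
  let x : Module.End k M := Algebra.lsmul k k M (gen k .x)
  let X : Module.End k M := Algebra.lsmul k k M (gen k .X)
  have pencil_smul (α β : k) (v : M) : pencil k α β • v = (α • x + β • X) v := by
    simp [pencil, add_smul, x, X]
  have hker : LinearMap.ker (x * X) ≤ LinearMap.range x ⊔ LinearMap.range X := by
    refine ker_mul_le_range_sup_range (fun v => ?_) (fun v => ?_) (fun v => ?_)
      fun α β hαβ v hv => ?_
    · exact (smul_smul _ _ v).trans (by rw [gen_x_mul_self, zero_smul])
    · exact (smul_smul _ _ v).trans (by rw [gen_X_mul_self, zero_smul])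
    · exact (gen_x_smul_gen_X_smul_add v).trans (by rw [hM, sub_self])
    · obtain ⟨w, hw⟩ := (hC α β hαβ).exists_smul_eq ((pencil_smul α β v).trans hv)
      exact ⟨w, (pencil_smul α β w).symm.trans hw⟩
  obtain ⟨_, ⟨a, rfl⟩, _, ⟨b, rfl⟩, hab⟩ := Submodule.mem_sup.mp (hker hm)
  exact ⟨a, b, hab⟩

theorem hasUnitTrace_of_even [NeZero (2 : k)] : HasUnitTrace (casimir k) M := by
  obtain ⟨t, ht⟩ := exists_evenSocle_mul_trace hM
  refine .of_isUnit (isCasimir_casimir k) t ?_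
  have hnil : IsNilpotent ((isCasimir_casimir k).trace t - 1) :=
    isNilpotent_of_evenSocle_mul_eq_zero hM (fun _ => exists_gen_smul_add_gen_smul_eq hM hC)
      (by rw [mul_sub, ht, mul_one, sub_self])
  simpa using hnil.isUnit_one_add

end Even

theorem hasUnitTrace_of_forall_hasContraction [NeZero (2 : k)] [IsAlgClosed k]
    [FiniteDimensional k M]
    (hM : ∀ α β : k, (α, β) ≠ (0, 0) → HasContraction k (pencil k α β) M) :
    HasUnitTrace (casimir k) M := by
  have _ : FiniteDimensional k (LinearMap.range (evenProj k M)) :=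
    .of_injective ((LinearMap.range (evenProj k M)).subtype.restrictScalars k)
      (Submodule.injective_subtype _)
  refine .of_isIdempotentElem (e := evenProj k M) ?_ ?_
  · refine hasUnitTrace_of_even ?_ fun α β h => (hM α β h).range isIdempotentElem_evenProj
    rintro ⟨_, m, rfl⟩
    exact Subtype.ext (gen_g_mul_gen_G_smul_evenProj m)
  · refine hasUnitTrace_of_odd ?_
    rintro ⟨_, m, rfl⟩
    exact Subtype.ext (gen_g_mul_gen_G_smul_one_sub_evenProj m)

end Dade

end DTaft

section ExactSequences

variable {R M₁ M₂ M₃ : Type*} [Ring R]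
  [AddCommGroup M₁] [Module R M₁] [AddCommGroup M₂] [Module R M₂] [AddCommGroup M₃] [Module R M₃]
  {f : M₁ →ₗ[R] M₂} {h : M₂ →ₗ[R] M₃} (hf : Function.Injective f) (hfh : Function.Exact f h)
  (hh : Function.Surjective h)
include hf hfh hh

theorem projective_left_of_exact (hM₂ : Module.Projective R M₂) (hM₃ : Module.Projective R M₃) :
    Module.Projective R M₁ := by
  obtain ⟨r, hr⟩ := ((hfh.split_tfae hf hh).out 0 1).mp
    (Module.projective_lifting_property h LinearMap.id hh)
  exact .of_split f r hr

theorem projective_middle_of_exact (hM₁ : Module.Projective R M₁) (hM₃ : Module.Projective R M₃) :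
    Module.Projective R M₂ := by
  obtain ⟨e, -⟩ := ((hfh.split_tfae hf hh).out 0 2).mp
    (Module.projective_lifting_property h LinearMap.id hh)
  exact .of_equiv e.symm

theorem projective_right_of_exact {k : Type*} [Field k] [Algebra k R] [Module k M₁]
    [IsScalarTower k R M₁] [Module k M₂] [IsScalarTower k R M₂] {T : R ⊗[k] R} (hT : IsCasimir T)
    (hM₁ : HasUnitTrace T M₁) (hM₂ : Module.Projective R M₂) : Module.Projective R M₃ := by
  obtain ⟨s, hs⟩ := ((hfh.split_tfae hf hh).out 0 1).mpr
    (hM₁.exists_extension hT f hf LinearMap.id)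
  exact .of_split s h hs

end ExactSequences

theorem injective_of_retract {R : Type*} [Ring R] {M N : Type u} [AddCommGroup M] [Module R M]
    [AddCommGroup N] [Module R N] (hM : Module.Injective R M) (i : N →ₗ[R] M) (r : M →ₗ[R] N)
    (hri : r ∘ₗ i = LinearMap.id) : Module.Injective R N where
  out _ _ _ _ _ _ f hf w := by
    obtain ⟨v, hv⟩ := hM.out f hf (i ∘ₗ w)
    exact ⟨r ∘ₗ v, fun a => (congrArg r (hv a)).trans (LinearMap.congr_fun hri (w a))⟩

section Covers

variable {R P M : Type*} [Ring R] [AddCommGroup P] [Module R P] [AddCommGroup M] [Module R M]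
  {π : P →ₗ[R] M} {U : Submodule R P} (hU : Minimal (fun V => V.map π = ⊤) U)
include hU

theorem range_comp_subtype_of_minimal : LinearMap.range (π ∘ₗ U.subtype) = ⊤ := by
  rw [LinearMap.range_comp, Submodule.range_subtype, hU.prop]

theorem eq_top_of_sup_ker_eq_top_of_minimal {V : Submodule R U}
    (hV : V ⊔ LinearMap.ker (π ∘ₗ U.subtype) = ⊤) : V = ⊤ := by
  rw [← LinearMap.map_eq_top_iff (range_comp_subtype_of_minimal hU), Submodule.map_comp] at hV
  refine Submodule.map_injective_of_injective U.injective_subtype ?_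
  rw [Submodule.map_subtype_top]
  exact (Submodule.map_subtype_le U V).antisymm (hU.le_of_le hV (Submodule.map_subtype_le U V))

theorem exists_retraction_of_minimal [IsNoetherian R P] [Module.Projective R P] :
    ∃ r : P →ₗ[R] U, r ∘ₗ U.subtype = LinearMap.id := by
  have hπU := LinearMap.range_eq_top.mp (range_comp_subtype_of_minimal hU)
  obtain ⟨ψ, hψ⟩ := Module.projective_lifting_property _ π hπU
  have hmap : (LinearMap.range (U.subtype ∘ₗ ψ ∘ₗ U.subtype)).map π = ⊤ := by
    rw [← LinearMap.range_comp, ← LinearMap.comp_assoc, ← LinearMap.comp_assoc, hψ,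
      LinearMap.range_eq_top]
    exact hπU
  have hle := hU.le_of_le hmap (LinearMap.range_comp_le_range _ _ |>.trans_eq U.range_subtype)
  have hsurj : Function.Surjective (ψ ∘ₗ U.subtype) := fun u => by
    obtain ⟨v, hv⟩ := hle u.2
    exact ⟨v, Subtype.ext hv⟩
  let e := LinearEquiv.ofBijective (ψ ∘ₗ U.subtype)
    (IsNoetherian.bijective_of_surjective_endomorphism _ hsurj)
  exact ⟨e.symm.toLinearMap ∘ₗ ψ, LinearMap.ext e.symm_apply_apply⟩

end Covers

section Hulls

variable {R M I : Type*} [Ring R] [AddCommGroup M] [Module R M] [AddCommGroup I] [Module R I]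
  {ι : M →ₗ[R] I} {U : Submodule R I} (hU : Maximal (fun V => V.comap ι = ⊥) U)
include hU

theorem ker_mkQ_comp_of_maximal : LinearMap.ker (U.mkQ ∘ₗ ι) = ⊥ := by
  rw [LinearMap.ker_comp, Submodule.ker_mkQ, hU.prop]

theorem eq_bot_of_inf_range_eq_bot_of_maximal {V : Submodule R (I ⧸ U)}
    (hV : V ⊓ LinearMap.range (U.mkQ ∘ₗ ι) = ⊥) : V = ⊥ := by
  have hVι : (V.comap U.mkQ).comap ι = ⊥ := by
    rw [← Submodule.comap_comp, ← ker_mkQ_comp_of_maximal hU, ← Submodule.comap_bot, ← hV,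
      Submodule.comap_inf, LinearMap.range_eq_map, Submodule.comap_map_eq, top_sup_eq, inf_top_eq]
  rw [← Submodule.map_comap_eq_of_surjective U.mkQ_surjective V, eq_bot_iff, ← U.mkQ_map_self]
  exact Submodule.map_mono (hU.le_of_ge hVι (U.le_comap_mkQ V))

end Hulls

theorem exists_section_of_maximal {R : Type*} [Ring R] {M I : Type u} [AddCommGroup M] [Module R M]
    [AddCommGroup I] [Module R I] [IsArtinian R I] {ι : M →ₗ[R] I} {U : Submodule R I}
    (hU : Maximal (fun V => V.comap ι = ⊥) U) (hI : Module.Injective R I) :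
    ∃ s : (I ⧸ U) →ₗ[R] I, U.mkQ ∘ₗ s = LinearMap.id := by
  have hιU := LinearMap.ker_eq_bot.mp (ker_mkQ_comp_of_maximal hU)
  obtain ⟨ψ, hψ⟩ := hI.out _ hιU ι
  have hψ : ψ ∘ₗ U.mkQ ∘ₗ ι = ι := LinearMap.ext hψ
  have hcomap : (LinearMap.ker (U.mkQ ∘ₗ ψ ∘ₗ U.mkQ)).comap ι = ⊥ := by
    rw [← LinearMap.ker_comp, LinearMap.comp_assoc, LinearMap.comp_assoc, hψ,
      LinearMap.ker_eq_bot]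
    exact hιU
  have hle := hU.le_of_ge hcomap
    (U.ker_mkQ.symm.trans_le (LinearMap.ker_le_ker_comp U.mkQ (U.mkQ ∘ₗ ψ)))
  have hinj : Function.Injective (U.mkQ ∘ₗ ψ) := by
    rw [injective_iff_map_eq_zero]
    intro v hv
    obtain ⟨v, rfl⟩ := U.mkQ_surjective v
    exact (Submodule.Quotient.mk_eq_zero U).mpr (hle hv)
  let e := LinearEquiv.ofBijective (U.mkQ ∘ₗ ψ)
    (IsArtinian.bijective_of_injective_endomorphism _ hinj)
  exact ⟨ψ ∘ₗ e.symm.toLinearMap, LinearMap.ext e.apply_symm_apply⟩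

namespace FDMod

variable {k A : Type u} [Field k] [Ring A] [Algebra k A]

/-- A submodule of a finite-dimensional module, as a finite-dimensional module. -/
def ofSubmodule (M : FDMod k A) (U : Submodule A M) : FDMod k A where
  carrier := U
  finiteDimensional :=
    .of_injective (U.subtype.restrictScalars k) U.injective_subtype

/-- A quotient of a finite-dimensional module, as a finite-dimensional module. -/
def quotient (M : FDMod k A) (U : Submodule A M) : FDMod k A where
  carrier := M ⧸ U
  finiteDimensional := .of_surjective (U.mkQ.restrictScalars k) U.mkQ_surjective

instance (M : FDMod k A) : IsNoetherian A M :=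
  isNoetherian_of_tower k inferInstance

instance (M : FDMod k A) : IsArtinian A M :=
  isArtinian_of_tower k inferInstance

theorem exists_isProjectiveCover {P M : FDMod k A} (hP : Module.Projective A P) (π : P →ₗ[A] M)
    (hπ : Function.Surjective π) : ∃ (Q : FDMod k A) (ρ : Q →ₗ[A] M), IsProjectiveCover ρ := by
  obtain ⟨U, hU⟩ := exists_minimal_of_wellFoundedLT (fun V : Submodule A P => V.map π = ⊤)
    ⟨⊤, by rw [Submodule.map_top, LinearMap.range_eq_top.mpr hπ]⟩
  obtain ⟨r, hr⟩ := exists_retraction_of_minimal hU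
  exact ⟨P.ofSubmodule U, π ∘ₗ U.subtype, Module.Projective.of_split U.subtype r hr,
    LinearMap.range_eq_top.mp (range_comp_subtype_of_minimal hU),
    fun _ => eq_top_of_sup_ker_eq_top_of_minimal hU⟩

theorem exists_isInjectiveHull {M I : FDMod k A} (hI : Module.Injective A I) (ι : M →ₗ[A] I)
    (hι : Function.Injective ι) : ∃ (J : FDMod k A) (κ : M →ₗ[A] J), IsInjectiveHull κ := by
  obtain ⟨U, hU⟩ := exists_maximal_of_wellFoundedGT (fun V : Submodule A I => V.comap ι = ⊥)
    ⟨⊥, LinearMap.ker_eq_bot.mpr hι⟩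
  obtain ⟨s, hs⟩ := exists_section_of_maximal hU hI
  exact ⟨I.quotient U, U.mkQ ∘ₗ ι, injective_of_retract hI s U.mkQ hs,
    LinearMap.ker_eq_bot.mp (ker_mkQ_comp_of_maximal hU),
    fun _ => eq_bot_of_inf_range_eq_bot_of_maximal hU⟩

theorem exists_isOmega {P M : FDMod k A} (hP : Module.Projective A P) (π : P →ₗ[A] M)
    (hπ : Function.Surjective π) : ∃ N : FDMod k A, IsOmega M N := by
  obtain ⟨Q, ρ, hρ⟩ := exists_isProjectiveCover hP π hπ
  exact ⟨Q.ofSubmodule (LinearMap.ker ρ), Q, (LinearMap.ker ρ).subtype, ρ, hρ,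
    Submodule.injective_subtype _, LinearMap.exact_subtype_ker_map ρ⟩

theorem exists_isOmegaInv {M I : FDMod k A} (hI : Module.Injective A I) (ι : M →ₗ[A] I)
    (hι : Function.Injective ι) : ∃ N : FDMod k A, IsOmegaInv M N := by
  obtain ⟨J, κ, hκ⟩ := exists_isInjectiveHull hI ι hι
  exact ⟨J.quotient (LinearMap.range κ), J, κ, (LinearMap.range κ).mkQ, hκ,
    Submodule.mkQ_surjective _, LinearMap.exact_map_mkQ_range κ⟩

theorem eq_of_iterateRel {R : FDMod k A → FDMod k A → Prop} {S : Type*} {V : FDMod k A → S}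
    (hiso : ∀ {M N : FDMod k A}, (M ≃ₗ[A] N) → V M = V N) (hR : ∀ {M N}, R M N → V N = V M)
    {n : ℕ} {M N : FDMod k A} (h : IterateRel R n M N) : V N = V M := by
  induction n generalizing N with
  | zero => exact h.elim fun e => (hiso e).symm
  | succ n ih =>
    obtain ⟨L, hL, hLN⟩ := h
    exact (hR hLN).trans (ih hL)

theorem exists_iterateRel {R : FDMod k A → FDMod k A → Prop} (hR : ∀ M, ∃ N, R M N) (n : ℕ)
    (M : FDMod k A) : ∃ N, IterateRel R n M N := by
  induction n with
  | zero => exact ⟨M, ⟨.refl A M⟩⟩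
  | succ n ih =>
    obtain ⟨L, hL⟩ := ih
    obtain ⟨N, hN⟩ := hR L
    exact ⟨N, L, hL, hN⟩

end FDMod

namespace DTaft

section RankVariety

variable {k : Type u} [Field k]

theorem mem_rankVariety_iff {M : FDMod k (D k)} {p : k × k} (hp : p ≠ (0, 0)) :
    p ∈ rankVariety k M ↔ ¬ Module.Projective (H k p.1 p.2) M :=
  or_iff_right hp

theorem zero_mem_rankVariety (M : FDMod k (D k)) : (0 : k × k) ∈ rankVariety k M :=
  Or.inl rfl

theorem rankVariety_eq_singleton_zero_iff {M : FDMod k (D k)} : rankVariety k M = {0} ↔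
    ∀ α β : k, (α, β) ≠ (0, 0) → Module.Projective (H k α β) M := by
  refine ⟨fun hM α β hαβ => ?_, fun hM => ?_⟩
  · by_contra hproj
    exact hαβ (hM.subset ((mem_rankVariety_iff hαβ).mpr hproj))
  · refine (Set.singleton_subset_iff.mpr (zero_mem_rankVariety M)).antisymm' fun p hp => ?_
    by_contra hp₀
    exact (mem_rankVariety_iff hp₀).mp hp (hM p.1 p.2 hp₀)

theorem rankVariety_subset_union {M N L : FDMod k (D k)}
    (h : ∀ α β : k, (α, β) ≠ (0, 0) → Module.Projective (H k α β) N →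
      Module.Projective (H k α β) L → Module.Projective (H k α β) M) :
    rankVariety k M ⊆ rankVariety k N ∪ rankVariety k L := by
  intro p hp
  by_cases hp₀ : p = (0, 0)
  · exact Or.inl (hp₀ ▸ zero_mem_rankVariety N)
  · rw [Set.mem_union, mem_rankVariety_iff hp₀, mem_rankVariety_iff hp₀, ← not_and_or]
    exact fun ⟨hN, hL⟩ => (mem_rankVariety_iff hp₀).mp hp (h p.1 p.2 hp₀ hN hL)

theorem rankVariety_subset_of_retract {M N : FDMod k (D k)} (i : M →ₗ[D k] N) (r : N →ₗ[D k] M)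
    (hri : r ∘ₗ i = LinearMap.id) : rankVariety k M ⊆ rankVariety k N :=
  fun p => Or.imp_right fun hM _ => hM <| .of_split (i.restrictScalars (H k p.1 p.2))
    (r.restrictScalars (H k p.1 p.2)) (LinearMap.ext fun m => LinearMap.congr_fun hri m)

theorem rankVariety_congr {M N : FDMod k (D k)} (e : M ≃ₗ[D k] N) :
    rankVariety k M = rankVariety k N :=
  (rankVariety_subset_of_retract e.toLinearMap e.symm.toLinearMap e.symm_comp).antisymm
    (rankVariety_subset_of_retract e.symm.toLinearMap e.toLinearMap e.comp_symm)

variable [NeZero (2 : k)]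

theorem rankVariety_eq_singleton_zero {M : FDMod k (D k)} (hM : HasUnitTrace (casimir k) M) :
    rankVariety k M = {0} :=
  rankVariety_eq_singleton_zero_iff.mpr fun _ _ h =>
    (H.projective_iff_hasContraction h).mpr (hasContraction_pencil hM h)

theorem projective_iff_rankVariety_eq_singleton_zero [IsAlgClosed k] {M : FDMod k (D k)} :
    Module.Projective (D k) M ↔ rankVariety k M = {0} := by
  rw [projective_iff_hasUnitTrace]
  refine ⟨rankVariety_eq_singleton_zero, fun hM => hasUnitTrace_of_forall_hasContraction ?_⟩
  exact fun α β h => (H.projective_iff_hasContraction h).mp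
    (rankVariety_eq_singleton_zero_iff.mp hM α β h)

variable (k) in
theorem detectsProjectivity_H [IsAlgClosed k] :
    DetectsProjectivity {B : Subalgebra k (D k) | ∃ α β : k, (α, β) ≠ (0, 0) ∧ B = H k α β} := by
  intro M
  rw [projective_iff_rankVariety_eq_singleton_zero, rankVariety_eq_singleton_zero_iff]
  refine ⟨?_, fun h α β hαβ => h _ ⟨α, β, hαβ, rfl⟩⟩
  rintro h _ ⟨α, β, hαβ, rfl⟩
  exact h α β hαβ

variable (k) in
theorem condC2_rankVariety : CondC2 (rankVariety k) := by
  intro M₁ M₂ M₃ f h hf hfh hh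
  refine ⟨rankVariety_subset_union fun α β _ h₂ h₃ => ?_,
    rankVariety_subset_union fun α β _ h₁ h₃ => ?_,
    rankVariety_subset_union fun α β hαβ h₁ h₂ => ?_⟩
  · exact projective_left_of_exact (R := H k α β) (f := f.restrictScalars (H k α β))
      (h := h.restrictScalars (H k α β)) hf hfh hh h₂ h₃
  · exact projective_middle_of_exact (R := H k α β) (f := f.restrictScalars (H k α β))
      (h := h.restrictScalars (H k α β)) hf hfh hh h₁ h₃
  · exact projective_right_of_exact (f := f.restrictScalars (H k α β))
      (h := h.restrictScalars (H k α β)) hf hfh hh (H.isCasimir k α β)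
      (H.hasUnitTrace ((H.projective_iff_hasContraction hαβ).mp h₁)) h₂

variable (k) in
theorem condC1_rankVariety : CondC1 (rankVariety k) := by
  intro M N
  obtain ⟨-, hsub, -⟩ := condC2_rankVariety k M (M.directSum N) N (LinearMap.inl (D k) M N)
    (LinearMap.snd (D k) M N) LinearMap.inl_injective .inl_snd LinearMap.snd_surjective
  refine hsub.antisymm (Set.union_subset ?_ ?_)
  · exact rankVariety_subset_of_retract (LinearMap.inl (D k) M N) (LinearMap.fst (D k) M N) rfl
  · exact rankVariety_subset_of_retract (LinearMap.inr (D k) M N) (LinearMap.snd (D k) M N) rfl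

theorem rankVariety_left_eq_right_of_exact {M₁ M₂ M₃ : FDMod k (D k)} {f : M₁ →ₗ[D k] M₂}
    {h : M₂ →ₗ[D k] M₃} (hf : Function.Injective f) (hfh : Function.Exact f h)
    (hh : Function.Surjective h) (hM₂ : HasUnitTrace (casimir k) M₂) :
    rankVariety k M₁ = rankVariety k M₃ := by
  have singleton_subset (M : FDMod k (D k)) : {0} ⊆ rankVariety k M :=
    Set.singleton_subset_iff.mpr (zero_mem_rankVariety M)
  obtain ⟨h₁, -, h₃⟩ := condC2_rankVariety k M₁ M₂ M₃ f h hf hfh hh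
  rw [rankVariety_eq_singleton_zero hM₂] at h₁ h₃
  rw [Set.union_eq_right.mpr (singleton_subset M₃)] at h₁
  rw [Set.union_eq_left.mpr (singleton_subset M₁)] at h₃
  exact h₁.antisymm h₃

theorem rankVariety_eq_of_isOmega {M N : FDMod k (D k)} (h : FDMod.IsOmega M N) :
    rankVariety k N = rankVariety k M := by
  obtain ⟨P, i, π, ⟨hP, hπ, -⟩, hi, hiπ⟩ := h
  exact rankVariety_left_eq_right_of_exact hi hiπ hπ (projective_iff_hasUnitTrace.mp hP)

theorem rankVariety_eq_of_isOmegaInv {M N : FDMod k (D k)} (h : FDMod.IsOmegaInv M N) :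
    rankVariety k N = rankVariety k M := by
  obtain ⟨I, ι, p, ⟨hI, hι, -⟩, hp, hιp⟩ := h
  exact (rankVariety_left_eq_right_of_exact hι hιp hp (injective_iff_hasUnitTrace.mp hI)).symm

/-- The envelope of a finite-dimensional module, as a finite-dimensional module. -/
noncomputable def envelope (M : FDMod k (D k)) : FDMod k (D k) where
  carrier := Envelope k M

theorem exists_isOmega (M : FDMod k (D k)) : ∃ N, FDMod.IsOmega M N := by
  have hP : Module.Projective (D k) (Envelope k M) :=
    projective_iff_hasUnitTrace.mpr (Envelope.hasUnitTrace k M)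
  exact FDMod.exists_isOmega (P := envelope M) hP (Envelope.proj k M) (Envelope.proj_surjective k M)

theorem exists_isOmegaInv (M : FDMod k (D k)) : ∃ N, FDMod.IsOmegaInv M N := by
  have hI : Module.Injective (D k) (Envelope k M) :=
    injective_iff_hasUnitTrace.mpr (Envelope.hasUnitTrace k M)
  exact FDMod.exists_isOmegaInv (I := envelope M) hI (Envelope.incl k M)
    (Envelope.incl_injective k M)

variable (k) in
theorem condC3_rankVariety : CondC3 (rankVariety k)
  | .ofNat n, M => ⟨FDMod.exists_iterateRel exists_isOmega n M, fun _ =>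
      FDMod.eq_of_iterateRel rankVariety_congr rankVariety_eq_of_isOmega⟩
  | .negSucc n, M => ⟨FDMod.exists_iterateRel exists_isOmegaInv (n + 1) M, fun _ =>
      FDMod.eq_of_iterateRel rankVariety_congr rankVariety_eq_of_isOmegaInv⟩

end RankVariety

end DTaft

theorem mainTheorem4 (k : Type u) [Field k] [IsAlgClosed k] (hk : ringChar k ≠ 2) :
    DetectsProjectivity {B : Subalgebra k (DTaft.D k) |
        ∃ α β : k, (α, β) ≠ (0, 0) ∧ B = DTaft.H k α β} ∧
      CondC1 (DTaft.rankVariety k) ∧ CondC2 (DTaft.rankVariety k) ∧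
      CondC3 (DTaft.rankVariety k) ∧ CondC4 (DTaft.rankVariety k) := by
  have : NeZero (2 : k) := ⟨Ring.two_ne_zero hk⟩
  exact ⟨DTaft.detectsProjectivity_H k, DTaft.condC1_rankVariety k, DTaft.condC2_rankVariety k,
    DTaft.condC3_rankVariety k,
    fun _ => DTaft.projective_iff_rankVariety_eq_singleton_zero.symm⟩
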